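/- Let $R$ be an associative unital ring that is semi-local, i.e. $R/\mathrm{Jac}(R)$ is a finite product of matrix rings over division rings. Let $n \geq 3$ and let $e_1, \ldots, e_n \in R$ be a complete family of orthogonal idempotents ($e_i e_j = 0$ for $i \neq j$, $e_i^2 = e_i$, $\sum_i e_i = 1$) which are pairwise Morita equivalent, i.e. $e_i \in R e_j R$ for all $i, j$. Put $R_{ij} = e_i R e_j$, let $\mathrm{GL}(R) = R^*$ be the group of invertible elements of $R$, and for $i \neq j$, $a \in R_{ij}$ put $t_{ij}(a) = 1 + a \in \mathrm{GL}(R)$. The Steinberg group $\mathrm{St}(R)$ is the group generated by symbols $x_{ij}(a)$ for distinct $i, j \in \{1, \ldots, n\}$ and $a \in R_{ij}$, with the relations $x_{ij}(a)\, x_{ij}(b) = x_{ij}(a + b)$; $[x_{ij}(a), x_{kl}(b)] = 1$ for $j \neq k$ and $i \neq l$; $[x_{ij}(a), x_{jk}(b)] = x_{ik}(ab)$ for $i \neq k$, where $[x, y] = x y x^{-1} y^{-1}$. Let $\mathrm{st} \colon \mathrm{St}(R) \to \mathrm{GL}(R)$ be the homomorphism $x_{ij}(a) \mapsto t_{ij}(a)$.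 The diagonal group $D(R) = \{g \in \mathrm{GL}(R) \mid e_i g e_j = 0 \text{ for } i \neq j\}$ acts on $\mathrm{St}(R)$ by automorphisms via ${}^{g} x_{ij}(a) = x_{ij}(g a g^{-1})$; let $\mathrm{St}(R) \rtimes D(R)$ be the corresponding semidirect product. It maps to $\mathrm{GL}(R)$ by $(x, g) \mapsto \mathrm{st}(x)\, g$ and acts on $\mathrm{St}(R)$ by $(x, g) \cdot y = x\, ({}^{g} y)\, x^{-1}$. Then there is a unique action of $\mathrm{GL}(R)$ on $\mathrm{St}(R)$ by group automorphisms making $\mathrm{st}$ a crossed module, that is, such that $\mathrm{st}({}^{g} y) = g\, \mathrm{st}(y)\, g^{-1}$ and ${}^{\mathrm{st}(x)} y = x y x^{-1}$ for all $g \in \mathrm{GL}(R)$ and $x, y \in \mathrm{St}(R)$. Moreover, this action is consistent with the action of $\mathrm{St}(R) \rtimes D(R)$: the action of $\mathrm{St}(R) \rtimes D(R)$ on $\mathrm{St}(R)$ is the composition of $\mathrm{St}(R) \rtimes D(R) \to \mathrm{GL}(R)$ with the action of $\mathrm{GL}(R)$. -/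

import Mathlib

namespace IsotropicGL

open scoped commutatorElement

universe u

/-- A homomorphism `d : H → G` with an action `φ` of `G` on `H` by automorphisms is a precrossed
module if `d (ᵍh) = g * d h * g⁻¹`. -/
structure IsPrecrossedModule {H G : Type*} [Group H] [Group G]
    (d : H →* G) (φ : G →* MulAut H) : Prop where
  equivariant : ∀ (g : G) (h : H), d (φ g h) = g * d h * g⁻¹

/-- A crossed module is a precrossed module in which `d h` acts on `H` as conjugation by `h`. -/
structure IsCrossedModule {H G : Type*} [Group H] [Group G]
    (d : H →* G) (φ : G →* MulAut H) : Prop extends IsPrecrossedModule d φ where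
  peiffer : ∀ h h' : H, φ (d h) h' = h * h' * h⁻¹

/-- A unital ring is semi-local if its quotient by the Jacobson radical is semi-simple. -/
def IsSemiLocalRing (R : Type u) [Ring R] : Prop :=
  IsSemisimpleRing (R ⧸ Ring.jacobson R)

/-- Semi-simplicity in terms of finite products of matrix rings over division rings. -/
theorem isSemiLocalRing_iff (R : Type u) [Ring R] :
    IsSemiLocalRing R ↔
      ∃ (m : ℕ) (D : Fin m → Type u) (d : Fin m → ℕ) (_ : ∀ i, DivisionRing (D i)),
        Nonempty ((R ⧸ Ring.jacobson R) ≃+* ∀ i, Matrix (Fin (d i)) (Fin (d i)) (D i)) :=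
  isSemisimpleRing_iff_pi_matrix_divisionRing

section

variable {R : Type u} [Ring R]

/-- `a` Morita dominates `b` if `b` lies in the additive subgroup `R a R` (the two-sided ideal
generated by `a`). -/
def MoritaDominates (a b : R) : Prop :=
  b ∈ AddSubgroup.closure {x : R | ∃ r s : R, x = r * a * s}

/-- Two idempotents are Morita equivalent if they Morita dominate each other. -/
def MoritaEquivalent (a b : R) : Prop :=
  MoritaDominates a b ∧ MoritaDominates b a

variable {n : ℕ}

/-- The Peirce component `R_ij = e_i R e_j`. -/
def peirce (e : Fin n → R) (i j : Fin n) : AddSubgroup R where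
  carrier := {x | ∃ r : R, x = e i * r * e j}
  zero_mem' := ⟨0, by simp⟩
  add_mem' := by
    rintro _ _ ⟨r, rfl⟩ ⟨s, rfl⟩
    exact ⟨r + s, by rw [mul_add, add_mul]⟩
  neg_mem' := by
    rintro _ ⟨r, rfl⟩
    exact ⟨-r, by rw [mul_neg, neg_mul]⟩

/-- The multiplication `R_ij × R_jk → R_ik`. -/
def peirceMul {e : Fin n → R} {i j k : Fin n} (a : peirce e i j) (b : peirce e j k) :
    peirce e i k :=
  ⟨(a : R) * (b : R), by
    obtain ⟨_, r, rfl⟩ := a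
    obtain ⟨_, s, rfl⟩ := b
    exact ⟨r * e j * (e j * s), by simp only [mul_assoc]⟩⟩

theorem peirce_mul_zero {e : Fin n → R} (he : OrthogonalIdempotents e) {i j k l : Fin n}
    (hjk : j ≠ k) (a : peirce e i j) (b : peirce e k l) : (a : R) * (b : R) = 0 := by
  obtain ⟨_, r, rfl⟩ := a
  obtain ⟨_, s, rfl⟩ := b
  have h : e j * e k = 0 := he.ortho hjk
  calc e i * r * e j * (e k * s * e l) = e i * r * (e j * e k) * s * e l := by
        simp only [mul_assoc]
    _ = 0 := by rw [h]; simp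

/-- The symbols `x_ij(a)` with `i ≠ j` and `a ∈ R_ij`. -/
structure SteinbergGen (e : Fin n → R) where
  row : Fin n
  col : Fin n
  ne : row ≠ col
  val : peirce e row col

/-- The symbol `x_ij(a)` as an element of the free group. -/
def freeX (e : Fin n → R) {i j : Fin n} (hij : i ≠ j) (a : peirce e i j) :
    FreeGroup (SteinbergGen e) :=
  FreeGroup.of ⟨i, j, hij, a⟩

/-- The Steinberg relators; here `⁅x, y⁆ = x * y * x⁻¹ * y⁻¹`. -/
inductive SteinbergRel (e : Fin n → R) : FreeGroup (SteinbergGen e) → Prop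
  | add {i j : Fin n} (hij : i ≠ j) (a b : peirce e i j) :
      SteinbergRel e (freeX e hij a * freeX e hij b * (freeX e hij (a + b))⁻¹)
  | comm {i j k l : Fin n} (hij : i ≠ j) (hkl : k ≠ l) (hjk : j ≠ k) (hil : i ≠ l)
      (a : peirce e i j) (b : peirce e k l) :
      SteinbergRel e ⁅freeX e hij a, freeX e hkl b⁆
  | mul {i j k : Fin n} (hij : i ≠ j) (hjk : j ≠ k) (hik : i ≠ k)
      (a : peirce e i j) (b : peirce e j k) :
      SteinbergRel e (⁅freeX e hij a, freeX e hjk b⁆ * (freeX e hik (peirceMul a b))⁻¹)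

/-- The Steinberg group `St(R)` of the family `e`. -/
abbrev Steinberg (e : Fin n → R) : Type u :=
  PresentedGroup {w : FreeGroup (SteinbergGen e) | SteinbergRel e w}

/-- The generator `x_ij(a)` of the Steinberg group. -/
def steinbergX (e : Fin n → R) {i j : Fin n} (hij : i ≠ j) (a : peirce e i j) : Steinberg e :=
  PresentedGroup.of ⟨i, j, hij, a⟩

/-- The universal property of the Steinberg group. -/
def steinbergLift {G : Type*} [Group G] {e : Fin n → R}
    (f : ∀ {i j : Fin n}, i ≠ j → peirce e i j → G)
    (hadd : ∀ {i j : Fin n} (hij : i ≠ j) (a b : peirce e i j),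
      f hij a * f hij b = f hij (a + b))
    (hcomm : ∀ {i j k l : Fin n} (hij : i ≠ j) (hkl : k ≠ l), j ≠ k → i ≠ l →
      ∀ (a : peirce e i j) (b : peirce e k l), ⁅f hij a, f hkl b⁆ = 1)
    (hmul : ∀ {i j k : Fin n} (hij : i ≠ j) (hjk : j ≠ k) (hik : i ≠ k)
      (a : peirce e i j) (b : peirce e j k), ⁅f hij a, f hjk b⁆ = f hik (peirceMul a b)) :
    Steinberg e →* G :=
  PresentedGroup.toGroup (f := fun g : SteinbergGen e => f g.ne g.val) (by
    intro w hw
    induction hw with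
    | add hij a b => simp [freeX, hadd]
    | comm hij hkl hjk hil a b => simp [freeX, map_commutatorElement, hcomm hij hkl hjk hil]
    | mul hij hjk hik a b =>
      simp [freeX, map_commutatorElement, hmul hij hjk hik])

theorem steinbergLift_x {G : Type*} [Group G] {e : Fin n → R}
    (f : ∀ {i j : Fin n}, i ≠ j → peirce e i j → G) (hadd hcomm hmul)
    {i j : Fin n} (hij : i ≠ j) (a : peirce e i j) :
    steinbergLift f hadd hcomm hmul (steinbergX e hij a) = f hij a :=
  PresentedGroup.toGroup.of _

theorem steinberg_hom_ext {G : Type*} [Group G] {e : Fin n → R} {f g : Steinberg e →* G}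
    (h : ∀ {i j : Fin n} (hij : i ≠ j) (a : peirce e i j),
      f (steinbergX e hij a) = g (steinbergX e hij a)) : f = g :=
  PresentedGroup.ext fun x => h x.ne x.val

theorem steinbergX_add {e : Fin n → R} {i j : Fin n} (hij : i ≠ j) (a b : peirce e i j) :
    steinbergX e hij a * steinbergX e hij b = steinbergX e hij (a + b) :=
  PresentedGroup.mk_eq_mk_of_mul_inv_mem (SteinbergRel.add hij a b)

theorem steinbergX_comm {e : Fin n → R} {i j k l : Fin n} (hij : i ≠ j) (hkl : k ≠ l)
    (hjk : j ≠ k) (hil : i ≠ l) (a : peirce e i j) (b : peirce e k l) :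
    ⁅steinbergX e hij a, steinbergX e hkl b⁆ = 1 :=
  PresentedGroup.one_of_mem (SteinbergRel.comm hij hkl hjk hil a b)

theorem steinbergX_mul {e : Fin n → R} {i j k : Fin n} (hij : i ≠ j) (hjk : j ≠ k)
    (hik : i ≠ k) (a : peirce e i j) (b : peirce e j k) :
    ⁅steinbergX e hij a, steinbergX e hjk b⁆ = steinbergX e hik (peirceMul a b) :=
  PresentedGroup.mk_eq_mk_of_mul_inv_mem (SteinbergRel.mul hij hjk hik a b)

/-- The elementary transvection `t_ij(a) = 1 + a` in `GL(R) = Rˣ`. -/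
def transvection {e : Fin n → R} (he : OrthogonalIdempotents e) {i j : Fin n} (hij : i ≠ j)
    (a : peirce e i j) : Rˣ where
  val := 1 + a
  inv := 1 - a
  val_inv := by
    have h := peirce_mul_zero he hij.symm a a
    simp [mul_sub, add_mul, h]
  inv_val := by
    have h := peirce_mul_zero he hij.symm a a
    simp [mul_add, sub_mul, h]

/-- The homomorphism `st : St(R) → GL(R)`, `x_ij(a) ↦ t_ij(a)`. -/
def st {e : Fin n → R} (he : OrthogonalIdempotents e) : Steinberg e →* Rˣ :=
  steinbergLift (fun hij a => transvection he hij a)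
    (by
      intro i j hij a b
      ext
      have h := peirce_mul_zero he hij.symm a b
      simp [transvection, mul_add, add_mul, h, add_assoc])
    (by
      intro i j k l hij hkl hjk hil a b
      rw [commutatorElement_eq_one_iff_mul_comm]
      ext
      have h := peirce_mul_zero he hjk a b
      have h' := peirce_mul_zero he hil.symm b a
      simp only [transvection, Units.val_mul, mul_add, add_mul, h, h', mul_one, one_mul, add_zero]
      abel)
    (by
      intro i j k hij hjk hik a b
      rw [commutatorElement_def, mul_inv_eq_iff_eq_mul, mul_inv_eq_iff_eq_mul]
      ext
      have h₁ := peirce_mul_zero he hjk.symm (peirceMul a b) b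
      have h₂ := peirce_mul_zero he hik.symm b a
      have h₃ := peirce_mul_zero he hik.symm (peirceMul a b) a
      have hab : ((peirceMul a b : peirce e i k) : R) = (a : R) * (b : R) := rfl
      simp only [hab] at h₁ h₃
      simp only [transvection, Units.val_mul, hab, mul_add, add_mul, h₁, h₂, h₃, mul_one, one_mul,
        add_zero]
      abel)

theorem st_x {e : Fin n → R} (he : OrthogonalIdempotents e) {i j : Fin n} (hij : i ≠ j)
    (a : peirce e i j) : st he (steinbergX e hij a) = transvection he hij a :=
  steinbergLift_x _ _ _ _ hij a

theorem diag_commute {e : Fin n → R} (he : CompleteOrthogonalIdempotents e) {g : R}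
    (hg : ∀ i j : Fin n, i ≠ j → e i * g * e j = 0) (i : Fin n) : e i * g = g * e i := by
  have h₁ : e i * g = e i * g * e i := by
    calc e i * g = e i * g * ∑ j, e j := by rw [he.complete, mul_one]
      _ = ∑ j, e i * g * e j := Finset.mul_sum _ _ _
      _ = e i * g * e i :=
        Finset.sum_eq_single i (fun j _ hj => hg i j hj.symm) (by simp)
  have h₂ : g * e i = e i * g * e i := by
    calc g * e i = (∑ j, e j) * (g * e i) := by rw [he.complete, one_mul]
      _ = ∑ j, e j * (g * e i) := Finset.sum_mul _ _ _
      _ = e i * (g * e i) :=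
        Finset.sum_eq_single i (fun j _ hj => by rw [← mul_assoc]; exact hg j i hj) (by simp)
      _ = e i * g * e i := (mul_assoc _ _ _).symm
  rw [h₁, h₂]

/-- The diagonal group `D(R) = {g ∈ GL(R) | e_i g e_j = 0 for i ≠ j}`. -/
def diagGroup {e : Fin n → R} (he : CompleteOrthogonalIdempotents e) : Subgroup Rˣ where
  carrier := {g | ∀ i j : Fin n, i ≠ j → e i * (g : R) * e j = 0}
  one_mem' := by
    intro i j hij
    simpa using! he.ortho hij
  mul_mem' := by
    intro g h hg hh i j hij
    rw [Units.val_mul, ← mul_assoc, diag_commute he hg, mul_assoc, mul_assoc, ← mul_assoc (e i),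
      hh i j hij, mul_zero]
  inv_mem' := by
    intro g hg i j hij
    have h : e i * (↑g⁻¹ : R) = (↑g⁻¹ : R) * e i := by
      rw [Units.mul_inv_eq_iff_eq_mul, mul_assoc, diag_commute he hg, Units.inv_mul_cancel_left]
    rw [h, mul_assoc]
    have h' : e i * e j = 0 := he.ortho hij
    rw [h', mul_zero]

/-- For `g ∈ D(R)` and `a ∈ R_ij`, the element `g a g⁻¹` of `R_ij`. -/
def diagConj {e : Fin n → R} (he : CompleteOrthogonalIdempotents e) (g : diagGroup he)
    {i j : Fin n} (a : peirce e i j) : peirce e i j :=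
  ⟨((g : Rˣ) : R) * (a : R) * (((g⁻¹ : diagGroup he) : Rˣ) : R), by
    obtain ⟨_, r, rfl⟩ := a
    refine ⟨((g : Rˣ) : R) * r * (((g⁻¹ : diagGroup he) : Rˣ) : R), ?_⟩
    have h₁ := diag_commute he g.2 i
    have h₂ := diag_commute he (g⁻¹).2 j
    calc ((g : Rˣ) : R) * (e i * r * e j) * (((g⁻¹ : diagGroup he) : Rˣ) : R)
        = (((g : Rˣ) : R) * e i) * r * (e j * (((g⁻¹ : diagGroup he) : Rˣ) : R)) := by
          simp only [mul_assoc]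
      _ = _ := by rw [← h₁, h₂]; simp only [mul_assoc]⟩

/-- The endomorphism `x_ij(a) ↦ x_ij(g a g⁻¹)` of the Steinberg group, for `g ∈ D(R)`. -/
def diagEnd {e : Fin n → R} (he : CompleteOrthogonalIdempotents e) (g : diagGroup he) :
    Steinberg e →* Steinberg e :=
  steinbergLift (fun hij a => steinbergX e hij (diagConj he g a))
    (by
      intro i j hij a b
      rw [steinbergX_add]
      congr 1
      ext
      simp [diagConj, mul_add, add_mul])
    (by
      intro i j k l hij hkl hjk hil a b
      exact steinbergX_comm hij hkl hjk hil _ _)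
    (by
      intro i j k hij hjk hik a b
      rw [steinbergX_mul hij hjk hik]
      congr 1
      ext
      simp [diagConj, peirceMul, mul_assoc])

theorem diagEnd_x {e : Fin n → R} (he : CompleteOrthogonalIdempotents e) (g : diagGroup he)
    {i j : Fin n} (hij : i ≠ j) (a : peirce e i j) :
    diagEnd he g (steinbergX e hij a) = steinbergX e hij (diagConj he g a) :=
  steinbergLift_x _ _ _ _ hij a

theorem diagEnd_mul {e : Fin n → R} (he : CompleteOrthogonalIdempotents e)
    (g h : diagGroup he) : diagEnd he (g * h) = (diagEnd he g).comp (diagEnd he h) := by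
  refine steinberg_hom_ext fun hij a => ?_
  rw [MonoidHom.comp_apply, diagEnd_x, diagEnd_x, diagEnd_x]
  congr 1
  ext
  simp [diagConj, mul_assoc]

theorem diagEnd_one {e : Fin n → R} (he : CompleteOrthogonalIdempotents e) :
    diagEnd he 1 = MonoidHom.id _ := by
  refine steinberg_hom_ext fun hij a => ?_
  rw [MonoidHom.id_apply, diagEnd_x]
  congr 1
  ext
  simp [diagConj]

/-- The action of `D(R)` on `St(R)` by automorphisms, `ᵍx_ij(a) = x_ij(g a g⁻¹)`. -/
def diagAct {e : Fin n → R} (he : CompleteOrthogonalIdempotents e) :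
    diagGroup he →* MulAut (Steinberg e) where
  toFun g := MonoidHom.toMulEquiv (diagEnd he g) (diagEnd he g⁻¹)
    (by rw [← diagEnd_mul, inv_mul_cancel, diagEnd_one])
    (by rw [← diagEnd_mul, mul_inv_cancel, diagEnd_one])
  map_one' := by
    ext x
    exact DFunLike.congr_fun (diagEnd_one he) x
  map_mul' g h := by
    ext x
    exact DFunLike.congr_fun (diagEnd_mul he g h) x

theorem diagAct_x {e : Fin n → R} (he : CompleteOrthogonalIdempotents e) (g : diagGroup he)
    {i j : Fin n} (hij : i ≠ j) (a : peirce e i j) :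
    diagAct he g (steinbergX e hij a) = steinbergX e hij (diagConj he g a) :=
  diagEnd_x he g hij a

theorem peirce_left {e : Fin n → R} (he : OrthogonalIdempotents e) {i j : Fin n}
    (a : peirce e i j) : e i * (a : R) = a := by
  obtain ⟨_, r, rfl⟩ := a
  rw [← mul_assoc, ← mul_assoc, (he.idem i).eq]

theorem peirce_right {e : Fin n → R} (he : OrthogonalIdempotents e) {i j : Fin n}
    (a : peirce e i j) : (a : R) * e j = a := by
  obtain ⟨_, r, rfl⟩ := a
  rw [mul_assoc, (he.idem j).eq]

/-- The element `d_i(a) = 1 + a - e_i` of `D(R)`, for `a` invertible in `R_ii` with inverse `b`. -/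
def diagElem {e : Fin n → R} (he : CompleteOrthogonalIdempotents e) (i : Fin n)
    (a b : peirce e i i) (hab : (a : R) * (b : R) = e i) (hba : (b : R) * (a : R) = e i) :
    diagGroup he :=
  ⟨{ val := 1 + a - e i
     inv := 1 + b - e i
     val_inv := by
      have h₁ := peirce_left he.toOrthogonalIdempotents b
      have h₂ := peirce_right he.toOrthogonalIdempotents a
      simp only [mul_sub, mul_add, sub_mul, add_mul, mul_one, one_mul, h₁, h₂, hab,
        (he.idem i).eq]
      abel
     inv_val := by
      have h₁ := peirce_left he.toOrthogonalIdempotents a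
      have h₂ := peirce_right he.toOrthogonalIdempotents b
      simp only [mul_sub, mul_add, sub_mul, add_mul, mul_one, one_mul, h₁, h₂, hba,
        (he.idem i).eq]
      abel }, by
    intro j k hjk
    have hjk' : e j * e k = 0 := he.ortho hjk
    have hi : e j * e i * e k = 0 := by
      by_cases h : j = i
      · subst h
        rw [(he.idem j).eq, hjk']
      · have h' : e j * e i = 0 := he.ortho h
        rw [h', zero_mul]
    have ha : e j * (a : R) * e k = 0 := by
      by_cases h : j = i
      · subst h
        rw [peirce_left he.toOrthogonalIdempotents, ← peirce_right he.toOrthogonalIdempotents a,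
          mul_assoc, hjk', mul_zero]
      · have h' : e j * e i = 0 := he.ortho h
        rw [← peirce_left he.toOrthogonalIdempotents a, ← mul_assoc, h', zero_mul, zero_mul]
    change e j * (1 + (a : R) - e i) * e k = 0
    simp only [mul_sub, mul_add, sub_mul, add_mul, mul_one, hi, ha, hjk', add_zero, sub_zero]⟩

/-- `d_i(a)` fixes `x_jk(c)` for `j ≠ i ≠ k`. -/
theorem diagAct_diagElem_of_ne {e : Fin n → R} (he : CompleteOrthogonalIdempotents e) {i : Fin n}
    (a b : peirce e i i) (hab : (a : R) * (b : R) = e i) (hba : (b : R) * (a : R) = e i)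
    {j k : Fin n} (hjk : j ≠ k) (hij : i ≠ j) (hki : k ≠ i) (c : peirce e j k) :
    diagAct he (diagElem he i a b hab hba) (steinbergX e hjk c) = steinbergX e hjk c := by
  rw [diagAct_x]
  congr 1
  ext
  have h₁ := peirce_mul_zero he.toOrthogonalIdempotents hij a c
  have h₂ := peirce_mul_zero he.toOrthogonalIdempotents hki c b
  have h₃ : e i * (c : R) = 0 := by
    have h' : e i * e j = 0 := he.ortho hij
    rw [← peirce_left he.toOrthogonalIdempotents c, ← mul_assoc, h', zero_mul]
  have h₄ : (c : R) * e i = 0 := by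
    have h' : e k * e i = 0 := he.ortho hki
    rw [← peirce_right he.toOrthogonalIdempotents c, mul_assoc, h', mul_zero]
  change (1 + (a : R) - e i) * (c : R) * (1 + (b : R) - e i) = c
  simp [mul_add, add_mul, mul_sub, sub_mul, h₁, h₂, h₃, h₄]

/-- `d_i(a)` sends `x_ij(c)` to `x_ij(a c)`. -/
theorem diagAct_diagElem_left {e : Fin n → R} (he : CompleteOrthogonalIdempotents e) {i j : Fin n}
    (a b : peirce e i i) (hab : (a : R) * (b : R) = e i) (hba : (b : R) * (a : R) = e i)
    (hij : i ≠ j) (c : peirce e i j) :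
    diagAct he (diagElem he i a b hab hba) (steinbergX e hij c) =
      steinbergX e hij (peirceMul a c) := by
  rw [diagAct_x]
  congr 1
  ext
  have h₁ := peirce_left he.toOrthogonalIdempotents c
  have h₂ := peirce_mul_zero he.toOrthogonalIdempotents hij.symm c b
  have h₃ : (c : R) * e i = 0 := by
    have h' : e j * e i = 0 := he.ortho hij.symm
    rw [← peirce_right he.toOrthogonalIdempotents c, mul_assoc, h', mul_zero]
  change (1 + (a : R) - e i) * (c : R) * (1 + (b : R) - e i) = (a : R) * (c : R)
  simp [mul_add, add_mul, mul_sub, sub_mul, h₁, h₂, h₃, mul_assoc]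

/-- `d_i(a)` sends `x_ji(c)` to `x_ji(c a⁻¹)`. -/
theorem diagAct_diagElem_right {e : Fin n → R} (he : CompleteOrthogonalIdempotents e) {i j : Fin n}
    (a b : peirce e i i) (hab : (a : R) * (b : R) = e i) (hba : (b : R) * (a : R) = e i)
    (hji : j ≠ i) (c : peirce e j i) :
    diagAct he (diagElem he i a b hab hba) (steinbergX e hji c) =
      steinbergX e hji (peirceMul c b) := by
  rw [diagAct_x]
  congr 1
  ext
  have h₁ := peirce_right he.toOrthogonalIdempotents c
  have h₂ := peirce_mul_zero he.toOrthogonalIdempotents hji.symm a c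
  have h₃ : e i * (c : R) = 0 := by
    have h' : e i * e j = 0 := he.ortho hji.symm
    rw [← peirce_left he.toOrthogonalIdempotents c, ← mul_assoc, h', zero_mul]
  change (1 + (a : R) - e i) * (c : R) * (1 + (b : R) - e i) = (c : R) * (b : R)
  simp [mul_add, add_mul, mul_sub, sub_mul, h₁, h₂, h₃]

/-- The homomorphism `st` preserves the action of `D(R)`. -/
theorem st_diagAct {e : Fin n → R} (he : CompleteOrthogonalIdempotents e) (g : diagGroup he)
    (x : Steinberg e) :
    st he.toOrthogonalIdempotents (diagAct he g x) =
      (g : Rˣ) * st he.toOrthogonalIdempotents x * (g : Rˣ)⁻¹ := by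
  have h : (st he.toOrthogonalIdempotents).comp (diagAct he g).toMonoidHom =
      (MulAut.conj (g : Rˣ)).toMonoidHom.comp (st he.toOrthogonalIdempotents) := by
    refine steinberg_hom_ext fun hij a => ?_
    simp only [MonoidHom.comp_apply, MulEquiv.coe_toMonoidHom, MulAut.conj_apply]
    rw [diagAct_x, st_x, st_x]
    ext
    simp [transvection, diagConj, mul_add, add_mul]
  exact DFunLike.congr_fun h x

/-- The semidirect product `St(R) ⋊ D(R)`. -/
abbrev SteinbergDiag {e : Fin n → R} (he : CompleteOrthogonalIdempotents e) : Type u :=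
  SemidirectProduct (Steinberg e) (diagGroup he) (diagAct he)

/-- The homomorphism `St(R) ⋊ D(R) → GL(R)`, `(x, g) ↦ st(x) g`. -/
def steinbergDiagToGL {e : Fin n → R} (he : CompleteOrthogonalIdempotents e) :
    SteinbergDiag he →* Rˣ :=
  SemidirectProduct.lift (st he.toOrthogonalIdempotents) (diagGroup he).subtype (by
    intro g
    refine MonoidHom.ext fun x => ?_
    exact st_diagAct he g x)

/-- The action of `St(R) ⋊ D(R)` on `St(R)`: `St(R)` acts by conjugation and `D(R)` by `diagAct`,
so `(x, g)` sends `y` to `x (ᵍy) x⁻¹`. -/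
def steinbergDiagAct {e : Fin n → R} (he : CompleteOrthogonalIdempotents e) :
    SteinbergDiag he →* MulAut (Steinberg e) :=
  SemidirectProduct.lift MulAut.conj (diagAct he) (by
    intro g
    ext x y
    simp)

end

end IsotropicGL

/-! An action of `GL(R)` compatible with that of `St(R) ⋊ D(R)` must be computed by lifting `g` to
`St(R) ⋊ D(R)` and letting the lift act. Existence therefore amounts to two facts: the map to
`GL(R)` is onto (`steinbergDiagToGL_surjective`), and its kernel acts trivially on `St(R)`
(`ker_steinbergDiagToGL_le`). Semi-locality enters only through stable range one, which makes pivots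
invertible and so allows Gaussian elimination; this gives surjectivity.

For the kernel, take `w` in the subgroup generated by `x_ij` and `x_ji`. For `k` outside `{i, j}`,
conjugation by `w` acts on the row `R_ki ⊕ R_kj` and the column `R_ik ⊕ R_jk` by multiplication with
the matrix of `w`. If `st w` is diagonal, `w` thus acts as that diagonal element; the other roots
follow from commutators, thanks to `n ≥ 3` and Morita equivalence (`rank_one_eq_one`). Hence the
rank one Gauss decomposition lifts from matrices to `St(R)`, modulo elements that are trivial both
in `Aut(St(R))` and in `GL(R)`. It follows that the set `U⁺ U⁻ U⁺ D` is stable under left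
multiplication by generators (`hasGauss_mul`), so it is everything. Since `st` is injective on `U⁺`
and `U⁻`, the unipotent part of the decomposition of a kernel element is trivial
(`eq_one_of_gauss`).

For uniqueness, the Peiffer identity makes `ker st` central, and `St(R)` is generated by
commutators, so any crossed module action must restrict to the given one on `D(R)`
(`hom_ext_of_mod_center`). Surjectivity then determines it on `GL(R)`. -/

namespace IsotropicGL

open scoped commutatorElement

/-! ### Stable range one for semi-local rings. -/

/-- Bass's stable range condition `sr(R) = 1`. -/
def HasStableRankOne (R : Type*) [Ring R] : Prop :=
  ∀ x x' y y' : R, x' * x + y' * y = 1 → ∃ p, IsUnit (x + p * y)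

/-- The relation says that `y` maps onto the cokernel of `x`, which has the dimension of `ker x`.
Choose `p` so that `y * p` identifies `ker x` with a complement of the range of `x` and vanishes on
a complement of `ker x`. -/
theorem exists_isUnit_add_mul_of_end {D V : Type*} [DivisionRing D] [AddCommGroup V] [Module D V]
    [FiniteDimensional D V] (x x' y y' : Module.End D V) (h : x * x' + y * y' = 1) :
    ∃ p, IsUnit (x + y * p) := by
  let π := (LinearMap.range x).mkQ
  have hπx : ∀ v, π (x v) = 0 := fun v => by simp [π]
  have hsurj : Function.Surjective (π ∘ₗ y) := by
    intro q
    obtain ⟨v, rfl⟩ := (LinearMap.range x).mkQ_surjective q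
    refine ⟨y' v, ?_⟩
    have hv : x (x' v) + y (y' v) = v := DFunLike.congr_fun h v
    calc π (y (y' v)) = π (x (x' v) + y (y' v)) := by rw [map_add, hπx, zero_add]
      _ = π v := by rw [hv]
  obtain ⟨s, hs⟩ := LinearMap.exists_rightInverse_of_surjective _ (LinearMap.range_eq_top.2 hsurj)
  obtain ⟨ρ, hρ⟩ := LinearMap.exists_leftInverse_of_injective (LinearMap.ker x).subtype
    (LinearMap.ker_eq_bot.2 (Submodule.injective_subtype _))
  have hrank : Module.finrank D (LinearMap.ker x) = Module.finrank D (V ⧸ LinearMap.range x) := by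
    have h₁ := LinearMap.finrank_range_add_finrank_ker x
    have h₂ := Submodule.finrank_quotient_add_finrank (LinearMap.range x)
    omega
  let θ := LinearEquiv.ofFinrankEq _ _ hrank
  let p : Module.End D V := s ∘ₗ θ.toLinearMap ∘ₗ ρ
  have hinj : Function.Injective (x + y * p) := by
    rw [← LinearMap.ker_eq_bot, LinearMap.ker_eq_bot']
    intro v hv
    have hv' : x v + y (p v) = 0 := hv
    have hθ : θ (ρ v) = 0 := by
      have h₁ : π (x v + y (p v)) = θ (ρ v) := by
        rw [map_add, hπx, zero_add]
        exact DFunLike.congr_fun hs (θ (ρ v))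
      rw [← h₁, hv', map_zero]
    have hρv : ρ v = 0 := by simpa using hθ
    have hp : p v = 0 := by simp [p, hρv]
    rw [hp, map_zero, add_zero] at hv'
    have h₂ : ρ v = ⟨v, hv'⟩ := DFunLike.congr_fun hρ ⟨v, hv'⟩
    simpa [hρv] using congrArg Subtype.val h₂.symm
  exact ⟨p, (Module.End.isUnit_iff _).2 ⟨hinj, LinearMap.injective_iff_surjective.1 hinj⟩⟩

/-- Letting matrices act on row vectors reverses products, which turns the left-handed condition
into the right-handed one proved for endomorphisms. -/
theorem hasStableRankOne_matrix (D : Type*) [DivisionRing D] (d : ℕ) :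
    HasStableRankOne (Matrix (Fin d) (Fin d) D) := by
  intro x x' y y' h
  let E : Matrix (Fin d) (Fin d) D → Module.End D (Fin d → D) := Matrix.toLinearMapRight'
  have hE : ∀ a b, E (a * b) = E b * E a := fun a b => Matrix.toLinearMapRight'_mul a b
  have hE1 : E 1 = 1 := Matrix.toLinearMapRight'_one
  have hbij : Function.Bijective E := (Matrix.toLinearMapRight' (R := D)).bijective
  obtain ⟨q, hq⟩ := exists_isUnit_add_mul_of_end (E x) (E x') (E y) (E y') (by
    rw [← hE, ← hE, ← hE1, ← h]
    exact (map_add _ _ _).symm)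
  obtain ⟨p, rfl⟩ := hbij.2 q
  have hsum : E (x + p * y) = E x + E y * E p := by
    rw [← hE]
    exact map_add _ _ _
  rw [← hsum] at hq
  obtain ⟨u, hu⟩ := hq
  obtain ⟨w, hw⟩ := hbij.2 (↑u⁻¹ : Module.End D (Fin d → D))
  refine ⟨p, ⟨⟨x + p * y, w, ?_, ?_⟩, rfl⟩⟩
  · apply hbij.1
    rw [hE, hw, ← hu, hE1, u.inv_mul]
  · apply hbij.1
    rw [hE, hw, ← hu, hE1, u.mul_inv]

theorem hasStableRankOne_pi {ι : Type*} {S : ι → Type*} [∀ i, Ring (S i)]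
    (h : ∀ i, HasStableRankOne (S i)) : HasStableRankOne (∀ i, S i) := by
  intro x x' y y' hxy
  choose p hp using fun i => h i (x i) (x' i) (y i) (y' i) (congrFun hxy i)
  exact ⟨p, Pi.isUnit_iff.2 hp⟩

theorem HasStableRankOne.of_ringEquiv {R S : Type*} [Ring R] [Ring S] (f : R ≃+* S)
    (h : HasStableRankOne S) : HasStableRankOne R := by
  intro x x' y y' hxy
  obtain ⟨p, hp⟩ := h (f x) (f x') (f y) (f y') (by simpa using congrArg f hxy)
  refine ⟨f.symm p, ?_⟩
  simpa using hp.map f.symm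

/-- Otherwise the left ideal generated by `a` lies in a maximal one, which contains `a - 1` as well.
-/
theorem exists_left_inverse_of_sub_one_mem_jacobson {R : Type*} [Ring R] {a : R}
    (ha : a - 1 ∈ Ring.jacobson R) : ∃ b, b * a = 1 := by
  by_contra! hb
  have hne : Ideal.span {a} ≠ ⊤ := by
    rw [Ne, Ideal.eq_top_iff_one, Ideal.mem_span_singleton']
    simpa using hb
  obtain ⟨m, hm, hle⟩ := Ideal.exists_le_maximal _ hne
  have h₁ : a ∈ m := hle (Ideal.mem_span_singleton_self a)
  have h₂ : a - 1 ∈ m := Ring.jacobson_le_of_isMaximal m ha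
  exact hm.ne_top ((Ideal.eq_top_iff_one _).2 (by simpa using m.sub_mem h₁ h₂))

theorem isUnit_of_sub_one_mem_jacobson {R : Type*} [Ring R] {a : R}
    (ha : a - 1 ∈ Ring.jacobson R) : IsUnit a := by
  obtain ⟨b, hb⟩ := exists_left_inverse_of_sub_one_mem_jacobson ha
  -- The left inverse `b` is again congruent to 1, so it has a left inverse too, necessarily `a`.
  obtain ⟨c, hc⟩ := exists_left_inverse_of_sub_one_mem_jacobson (a := b) (by
    have h := (Ring.jacobson R).neg_mem ((Ring.jacobson R).mul_mem_left b ha)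
    rwa [mul_sub, hb, mul_one, neg_sub] at h)
  have hca : c = a := by
    calc c = c * (b * a) := by rw [hb, mul_one]
      _ = a := by rw [← mul_assoc, hc, one_mul]
  exact ⟨⟨a, b, hca ▸ hc, hb⟩, rfl⟩

theorem isUnit_of_isUnit_mk_jacobson {R : Type*} [Ring R] {a : R}
    (ha : IsUnit (Ideal.Quotient.mk (Ring.jacobson R) a)) : IsUnit a := by
  obtain ⟨u, hu⟩ := ha
  obtain ⟨b, hb⟩ := Ideal.Quotient.mk_surjective (↑u⁻¹ : R ⧸ Ring.jacobson R)
  have h₁ : IsUnit (a * b) := isUnit_of_sub_one_mem_jacobson (by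
    rw [← Ideal.Quotient.mk_eq_mk_iff_sub_mem, map_mul, map_one, hb, ← hu, u.mul_inv])
  have h₂ : IsUnit (b * a) := isUnit_of_sub_one_mem_jacobson (by
    rw [← Ideal.Quotient.mk_eq_mk_iff_sub_mem, map_mul, map_one, hb, ← hu, u.inv_mul])
  obtain ⟨v, hv⟩ := h₁
  obtain ⟨w, hw⟩ := h₂
  have h₃ : a * (b * ↑v⁻¹) = 1 := by rw [← mul_assoc, ← hv, v.mul_inv]
  have h₄ : ↑w⁻¹ * b * a = 1 := by rw [mul_assoc, ← hw, w.inv_mul]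
  exact ⟨⟨a, b * ↑v⁻¹, h₃, by rwa [← left_inv_eq_right_inv h₄ h₃]⟩, rfl⟩

theorem IsSemiLocalRing.hasStableRankOne {R : Type*} [Ring R] (hR : IsSemiLocalRing R) :
    HasStableRankOne R := by
  obtain ⟨m, D, d, _, ⟨f⟩⟩ := (isSemiLocalRing_iff R).1 hR
  have hS : HasStableRankOne (R ⧸ Ring.jacobson R) :=
    .of_ringEquiv f (hasStableRankOne_pi fun i => hasStableRankOne_matrix (D i) (d i))
  intro x x' y y' h
  let q := Ideal.Quotient.mk (Ring.jacobson R)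
  obtain ⟨p, hp⟩ := hS (q x) (q x') (q y) (q y') (by
    rw [← map_mul, ← map_mul, ← map_add, h, map_one])
  obtain ⟨p, rfl⟩ := Ideal.Quotient.mk_surjective p
  exact ⟨p, isUnit_of_isUnit_mk_jacobson (by rwa [map_add, map_mul])⟩

/-! ### Stable range in corners and elimination of a two-by-two block. -/

section Corner

variable {R : Type*} [Ring R]

/-- The unit `1 + a` for an element `a` of square zero. -/
def oneAdd (a : R) (ha : a * a = 0) : Rˣ where
  val := 1 + a
  inv := 1 - a
  val_inv := by simp [mul_sub, add_mul, ha]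
  inv_val := by simp [mul_add, sub_mul, ha]

/-- Stable range one in a corner `e R e`. -/
theorem HasStableRankOne.exists_corner (hR : HasStableRankOne R) {e f x x' y y' : R}
    (he : e * e = e) (hxl : e * x = x) (hxr : x * e = x) (hyl : f * y = y) (hyr : y * e = y)
    (h : x' * x + y' * y = e) (hf : f * f = f) :
    ∃ p u, e * p = p ∧ p * f = p ∧ e * u = u ∧ u * e = u ∧
      (x + p * y) * u = e ∧ u * (x + p * y) = e := by
  have hx1 : e * x' * x + e * y' * y = e := by rw [mul_assoc, mul_assoc, ← mul_add, h, he]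
  -- Adding `1 - e` extends the unimodular relation from the corner to all of `R`.
  have hz : (e * x' * e + (1 - e)) * (x + (1 - e)) + e * y' * y = 1 := by
    calc (e * x' * e + (1 - e)) * (x + (1 - e)) + e * y' * y
        = (e * x' * (e * x) + e * y' * y) + (x - e * x) + (1 - e - (e - e * e))
          + e * x' * (e - e * e) := by noncomm_ring
      _ = 1 := by rw [hxl, he, hx1]; noncomm_ring
  obtain ⟨p, w, hw⟩ := hR _ _ _ _ hz
  -- This is the part of `p * y` outside the corner. It lies in `(1 - e) R e`, so `1 + q` is a unit
  -- that can be divided out without changing the corner.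
  set q := (1 - e) * p * y with hq
  have hqe : q * e = q := by rw [hq, mul_assoc, hyr]
  have heq : e * q = 0 := by
    rw [hq, mul_assoc, ← mul_assoc, mul_sub, he, mul_one, sub_self, zero_mul]
  have hqq : q * q = 0 := by
    calc q * q = q * e * q := by rw [hqe]
      _ = 0 := by rw [mul_assoc, heq, mul_zero]
  set v := x + e * p * f * y with hv
  have hvl : e * v = v := by
    rw [hv, mul_add, hxl, ← mul_assoc, ← mul_assoc, ← mul_assoc, he]
  have hvr : v * e = v := by rw [hv, add_mul, hxr, mul_assoc, hyr]
  have hvq : v * q = 0 := by rw [← hvr, mul_assoc, heq, mul_zero]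
  have hvw : v + (1 - e) = ↑(w * (oneAdd q hqq)⁻¹) := by
    rw [Units.val_mul, Units.eq_mul_inv_iff_mul_eq, hw]
    change (v + (1 - e)) * (1 + q) = _
    calc (v + (1 - e)) * (1 + q) = v + (1 - e) + v * q + q - e * q := by noncomm_ring
      _ = x + (1 - e) + p * y := by
        rw [hvq, heq, hv, hq, mul_assoc (e * p), hyl]
        noncomm_ring
  -- This unit equals `v + (1 - e)`, so it commutes with `e`, and `e * g⁻¹` inverts `v` in the
  -- corner.
  set g := w * (oneAdd q hqq)⁻¹
  have hge : ∀ r, v * r = e * ((g : R) * r) := by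
    intro r
    rw [← hvw, ← mul_assoc, mul_add, hvl, mul_sub, he, mul_one, sub_self, add_zero]
  have hge' : ∀ r, r * v = r * (g : R) * e := by
    intro r
    rw [← hvw, mul_assoc, add_mul, hvr, sub_mul, he, one_mul, sub_self, add_zero]
  have hcomm : e * (g : R) = (g : R) * e := by
    rw [← hvw, mul_add, add_mul, hvl, hvr]
    noncomm_ring
  have hcomm' : e * (↑g⁻¹ : R) = (↑g⁻¹ : R) * e := by
    rw [Units.mul_inv_eq_iff_eq_mul, mul_assoc, hcomm, Units.inv_mul_cancel_left]
  refine ⟨e * p * f, e * (↑g⁻¹ : R), ?_, ?_, ?_, ?_, ?_, ?_⟩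
  · rw [← mul_assoc, ← mul_assoc, he]
  · rw [mul_assoc, hf]
  · rw [← mul_assoc, he]
  · rw [mul_assoc, ← hcomm', ← mul_assoc, he]
  · rw [← hv, ← mul_assoc, hvr, hge, g.mul_inv, mul_one]
  · rw [← hv, hge', mul_assoc e, g.inv_mul, mul_one, he]

/-- An invertible element commuting with `e + f` becomes block diagonal with respect to `e` and
`f` after multiplication by three transvections. -/
theorem HasStableRankOne.exists_block_diagonal (hR : HasStableRankOne R) {e f : R}
    (he : e * e = e) (hf : f * f = f) (hef : e * f = 0) (hfe : f * e = 0)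
    (g : Rˣ) (hg : Commute (g : R) (e + f)) :
    ∃ p q r : R, (e * p = p ∧ p * f = p) ∧ (f * q = q ∧ q * e = q) ∧ (e * r = r ∧ r * f = r) ∧
      Commute ((1 + q) * (1 + p) * g * (1 + r)) e ∧ Commute ((1 + q) * (1 + p) * g * (1 + r)) f ∧
      ∀ c : R, c * e = 0 → e * c = 0 → c * f = 0 → f * c = 0 → Commute (g : R) c →
        Commute ((1 + q) * (1 + p) * g * (1 + r)) c := by
  have hg' : Commute (↑g⁻¹ : R) (e + f) := by
    exact (hg.symm.units_inv_right).symm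
  -- This is the `(e, e)` entry of `g⁻¹ g = 1`: the first block column of `g` is unimodular. No
  -- third block enters because `g` commutes with `e + f`.
  have hsum : e * ↑g⁻¹ * e * (e * g * e) + e * ↑g⁻¹ * f * (f * g * e) = e := by
    calc e * ↑g⁻¹ * e * (e * g * e) + e * ↑g⁻¹ * f * (f * g * e)
        = e * ↑g⁻¹ * (e * e) * g * e + e * ↑g⁻¹ * (f * f) * g * e := by noncomm_ring
      _ = e * (↑g⁻¹ * (e + f)) * g * e := by rw [he, hf]; noncomm_ring
      _ = e * (e + f) * (↑g⁻¹ * g) * e := by rw [hg'.eq]; noncomm_ring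
      _ = e := by rw [g.inv_mul, mul_one, mul_add, he, hef, add_zero, he]
  obtain ⟨p, u, hp₁, hp₂, hu₁, hu₂, hvu, huv⟩ := hR.exists_corner (e := e) (f := f)
    (x := e * g * e) (y := f * g * e) he (by simp only [← mul_assoc, he])
    (by simp only [mul_assoc, he]) (by simp only [← mul_assoc, hf])
    (by simp only [mul_assoc, he]) hsum hf
  set v := e * g * e + p * (f * g * e) with hv
  obtain ⟨m, hm⟩ : ∃ m, m = (1 + p) * (g : R) := ⟨_, rfl⟩
  have hpe : p * e = 0 := by rw [← hp₂, mul_assoc, hfe, mul_zero]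
  have hfp : f * p = 0 := by rw [← hp₁, ← mul_assoc, hfe, zero_mul]
  have hme : e * m * e = v := by
    calc e * m * e = e * g * e + e * p * g * e := by rw [hm]; noncomm_ring
      _ = v := by rw [hp₁, hv, ← hp₂]; simp only [mul_assoc]; rw [← mul_assoc f f, hf]
  have hmh : Commute m (e + f) := by
    rw [hm]
    refine Commute.mul_left ?_ hg
    change (1 + p) * (e + f) = (e + f) * (1 + p)
    calc (1 + p) * (e + f) = e + f + (p * e + p * f) := by noncomm_ring
      _ = e + f + (e * p + f * p) := by rw [hpe, hp₂, hp₁, hfp]; abel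
      _ = _ := by noncomm_ring
  have hmh' : m * e + m * f = e * m + f * m := by
    simpa only [mul_add, add_mul] using hmh.eq
  have hemf : e * m = e * m * e + e * m * f := by
    calc e * m = e * (e * m + f * m) := by rw [mul_add, ← mul_assoc, he, ← mul_assoc, hef]; simp
      _ = e * m * e + e * m * f := by rw [← hmh']; noncomm_ring
  have hfem : m * e = e * m * e + f * m * e := by
    calc m * e = (m * e + m * f) * e := by rw [add_mul, mul_assoc, he, mul_assoc, hfe]; simp
      _ = e * m * e + f * m * e := by rw [hmh']; noncomm_ring
  -- After multiplication by `1 + p` the pivot `v` has inverse `u`; `q` and `r` clear the remaining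
  -- off-diagonal blocks below and to the right of it.
  set q := -(f * m * e * u) with hq
  set r := -(u * (e * m * f)) with hr
  have hfq : f * q = q := by rw [hq, mul_neg]; simp only [← mul_assoc, hf]
  have hqe : q * e = q := by rw [hq, neg_mul, mul_assoc, hu₂]
  have her : e * r = r := by rw [hr, mul_neg, ← mul_assoc, hu₁]
  have hrf : r * f = r := by rw [hr, neg_mul]; simp only [mul_assoc, hf]
  have heq : e * q = 0 := by rw [← hfq, ← mul_assoc, hef, zero_mul]
  have hre : r * e = 0 := by rw [← hrf, mul_assoc, hfe, mul_zero]
  have hqf : q * f = 0 := by rw [← hqe, mul_assoc, hef, mul_zero]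
  have hfr : f * r = 0 := by rw [← her, ← mul_assoc, hfe, zero_mul]
  have hqv : q * v = -(f * m * e) := by
    rw [hq, neg_mul, mul_assoc, huv, mul_assoc, he]
  have hvr : v * r = -(e * m * f) := by
    rw [hr, mul_neg, ← mul_assoc, hvu]; simp only [← mul_assoc, he]
  set M := (1 + q) * (1 + p) * g * (1 + r) with hM
  have hM' : M = (1 + q) * m * (1 + r) := by rw [hM, hm]; simp only [mul_assoc]
  have hMe : M * e = v := by
    calc M * e = (1 + q) * (m * e + m * (r * e)) := by rw [hM']; noncomm_ring
      _ = (1 + q) * (e * m * e + f * m * e) := by rw [hre, mul_zero, add_zero, ← hfem]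
      _ = e * m * e + f * m * e + q * (e * m * e) + (q * f) * m * e := by noncomm_ring
      _ = v := by rw [hqf, hme, hqv, zero_mul, zero_mul]; abel
  have heM : e * M = v := by
    calc e * M = (e * m + e * q * m) * (1 + r) := by rw [hM']; noncomm_ring
      _ = (e * m * e + e * m * f) * (1 + r) := by rw [heq, zero_mul, add_zero, ← hemf]
      _ = e * m * e + e * m * f + e * m * e * r + e * m * (f * r) := by noncomm_ring
      _ = v := by rw [hfr, hme, hvr, mul_zero]; abel
  have hMef : Commute M (e + f) := by
    rw [hM']
    refine Commute.mul_left (Commute.mul_left ?_ hmh) ?_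
    · change (1 + q) * (e + f) = (e + f) * (1 + q)
      calc (1 + q) * (e + f) = e + f + (q * e + q * f) := by noncomm_ring
        _ = e + f + (e * q + f * q) := by rw [hqe, hqf, heq, hfq]; abel
        _ = _ := by noncomm_ring
    · change (1 + r) * (e + f) = (e + f) * (1 + r)
      calc (1 + r) * (e + f) = e + f + (r * e + r * f) := by noncomm_ring
        _ = e + f + (e * r + f * r) := by rw [hre, hrf, her, hfr]; abel
        _ = _ := by noncomm_ring
  have hMe' : Commute M e := hMe.trans heM.symm
  refine ⟨p, q, r, ⟨hp₁, hp₂⟩, ⟨hfq, hqe⟩, ⟨her, hrf⟩, hMe', ?_, ?_⟩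
  · simpa using hMef.sub_right hMe'
  · intro c hce hec hcf hfc hgc
    have key : ∀ {a b t : R}, c * a = 0 → b * c = 0 → a * t = t → t * b = t →
        Commute (1 + t) c := by
      intro a b t hca hbc hat htb
      have h₁ : c * t = 0 := by rw [← hat, ← mul_assoc, hca, zero_mul]
      have h₂ : t * c = 0 := by rw [← htb, mul_assoc, hbc, mul_zero]
      change (1 + t) * c = c * (1 + t)
      rw [mul_add, add_mul, h₁, h₂, one_mul, mul_one]
    exact (((key hcf hec hfq hqe).mul_left (key hce hfc hp₁ hp₂)).mul_left hgc).mul_left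
      (key hce hfc her hrf)

end Corner

universe u

/-! ### Conjugation relations and unipotent root subgroups of the Steinberg group. -/

section Steinberg

variable {R : Type u} [Ring R] {n : ℕ} {e : Fin n → R}

/-- The component `e_i r e_j` of `r`. -/
def peirceProj (e : Fin n → R) (i j : Fin n) (r : R) : peirce e i j :=
  ⟨e i * r * e j, r, rfl⟩

theorem peirceProj_coe (he : OrthogonalIdempotents e) {i j : Fin n} (a : peirce e i j) :
    peirceProj e i j a = a :=
  Subtype.ext (by
    change e i * (a : R) * e j = a
    rw [peirce_left he, peirce_right he])

/-- If `e_k` Morita dominates `e_i`, then `R_ij` is additively generated by `R_ik R_kj`. -/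
theorem peirce_induction (he : OrthogonalIdempotents e) {i j k : Fin n}
    (hM : MoritaDominates (e k) (e i)) {P : peirce e i j → Prop}
    (hmul : ∀ (b : peirce e i k) (c : peirce e k j), P (peirceMul b c))
    (hzero : P 0) (hadd : ∀ a b, P a → P b → P (a + b)) (hneg : ∀ a, P a → P (-a))
    (a : peirce e i j) : P a := by
  -- The induction runs over `x` in `R e_k R` with `a` fixed; taking `x = e_i` recovers `a`.
  have h : ∀ x ∈ AddSubgroup.closure {x : R | ∃ r s : R, x = r * e k * s},
      P (peirceProj e i j (x * a)) := by
    intro x hx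
    induction hx using AddSubgroup.closure_induction with
    | mem x hx =>
      obtain ⟨r, s, rfl⟩ := hx
      convert hmul (peirceProj e i k r) (peirceProj e k j (s * a)) using 1
      refine Subtype.ext ?_
      change e i * (r * e k * s * a) * e j = e i * r * e k * (e k * (s * a) * e j)
      calc e i * (r * e k * s * a) * e j = e i * r * e k * s * a * e j := by
            simp only [mul_assoc]
        _ = e i * r * (e k * e k) * s * a * e j := by rw [(he.idem k).eq]
        _ = _ := by simp only [mul_assoc]
    | zero =>
      convert hzero using 1
      exact Subtype.ext (by simp [peirceProj])
    | add x y _ _ hx hy =>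
      convert hadd _ _ hx hy using 1
      exact Subtype.ext (by simp [peirceProj, add_mul, mul_add])
    | neg x _ hx =>
      convert hneg _ hx using 1
      exact Subtype.ext (by simp [peirceProj])
  simpa only [peirce_left he, peirceProj_coe he] using h _ hM

theorem steinbergX_zero {i j : Fin n} (hij : i ≠ j) :
    steinbergX e hij (0 : peirce e i j) = 1 := by
  have h := steinbergX_add hij (0 : peirce e i j) 0
  rw [add_zero] at h
  exact mul_eq_left.1 h

theorem steinbergX_neg {i j : Fin n} (hij : i ≠ j) (a : peirce e i j) :
    steinbergX e hij (-a) = (steinbergX e hij a)⁻¹ := by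
  rw [eq_inv_iff_mul_eq_one, steinbergX_add, neg_add_cancel, steinbergX_zero]

theorem steinbergX_conj_comm {i j k l : Fin n} (hij : i ≠ j) (hkl : k ≠ l)
    (hjk : j ≠ k) (hil : i ≠ l) (a : peirce e i j) (b : peirce e k l) :
    steinbergX e hij a * steinbergX e hkl b * (steinbergX e hij a)⁻¹ = steinbergX e hkl b := by
  have h := steinbergX_comm hij hkl hjk hil a b
  rwa [commutatorElement_def, mul_inv_eq_one] at h

theorem steinbergX_conj_left {i j k : Fin n} (hij : i ≠ j) (hjk : j ≠ k)
    (hik : i ≠ k) (a : peirce e i j) (b : peirce e j k) :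
    steinbergX e hij a * steinbergX e hjk b * (steinbergX e hij a)⁻¹ =
      steinbergX e hik (peirceMul a b) * steinbergX e hjk b := by
  rw [← steinbergX_mul hij hjk hik, commutatorElement_def, inv_mul_cancel_right]

theorem steinbergX_conj_right {i j k : Fin n} (hij : i ≠ j) (hki : k ≠ i)
    (hkj : k ≠ j) (a : peirce e i j) (b : peirce e k i) :
    steinbergX e hij a * steinbergX e hki b * (steinbergX e hij a)⁻¹ =
      steinbergX e hkj (-peirceMul b a) * steinbergX e hki b := by
  rw [steinbergX_neg, ← steinbergX_mul hki hij hkj, commutatorElement_inv, commutatorElement_def,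
    inv_mul_cancel_right]

theorem steinbergX_commute {i j k l : Fin n} (hij : i ≠ j) (hkl : k ≠ l)
    (hjk : j ≠ k) (hil : i ≠ l) (a : peirce e i j) (b : peirce e k l) :
    steinbergX e hij a * steinbergX e hkl b = steinbergX e hkl b * steinbergX e hij a :=
  commutatorElement_eq_one_iff_mul_comm.1 (steinbergX_comm hij hkl hjk hil a b)

theorem transvection_val (he : OrthogonalIdempotents e) {i j : Fin n} (hij : i ≠ j)
    (a : peirce e i j) : (transvection he hij a : R) = 1 + a := rfl

theorem st_x_val (he : OrthogonalIdempotents e) {i j : Fin n} (hij : i ≠ j)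
    (a : peirce e i j) : (st he (steinbergX e hij a) : R) = 1 + a := by
  rw [st_x, transvection_val]

theorem st_x_inv_val (he : OrthogonalIdempotents e) {i j : Fin n} (hij : i ≠ j)
    (a : peirce e i j) : ((st he (steinbergX e hij a))⁻¹ : Rˣ).val = 1 - a := by
  rw [st_x]
  rfl

theorem idem_mul_peirce (he : OrthogonalIdempotents e) {i j k : Fin n} (hki : k ≠ i)
    (a : peirce e i j) : e k * (a : R) = 0 := by
  have h : e k * e i = 0 := he.ortho hki
  rw [← peirce_left he a, ← mul_assoc, h, zero_mul]

theorem peirce_mul_idem (he : OrthogonalIdempotents e) {i j k : Fin n} (hjk : j ≠ k)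
    (a : peirce e i j) : (a : R) * e k = 0 := by
  have h : e j * e k = 0 := he.ortho hjk
  rw [← peirce_right he a, mul_assoc, h, mul_zero]

/-- The subgroup of the Steinberg group generated by the root subgroups from `Ψ`. -/
def rootSubgroup (e : Fin n → R) (Ψ : Set (Fin n × Fin n)) : Subgroup (Steinberg e) :=
  Subgroup.closure {x | ∃ (i j : Fin n) (hij : i ≠ j) (a : peirce e i j),
    (i, j) ∈ Ψ ∧ x = steinbergX e hij a}

theorem steinbergX_mem_rootSubgroup {Ψ : Set (Fin n × Fin n)} {i j : Fin n} (hij : i ≠ j)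
    (h : (i, j) ∈ Ψ) (a : peirce e i j) : steinbergX e hij a ∈ rootSubgroup e Ψ :=
  Subgroup.subset_closure ⟨i, j, hij, a, h, rfl⟩

/-- Induction on elements of a root subgroup by left multiplication with generators. -/
theorem rootSubgroup_induction {Ψ : Set (Fin n × Fin n)} {P : Steinberg e → Prop} (one : P 1)
    (mul : ∀ {i j : Fin n} (hij : i ≠ j) (a : peirce e i j), (i, j) ∈ Ψ → ∀ y,
      y ∈ rootSubgroup e Ψ → P y → P (steinbergX e hij a * y))
    {x : Steinberg e} (hx : x ∈ rootSubgroup e Ψ) : P x := by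
  induction hx using Subgroup.closure_induction_left with
  | one => exact one
  | mul_left x hx y hy h =>
    obtain ⟨i, j, hij, a, ha, rfl⟩ := hx
    exact mul hij a ha y hy h
  | inv_mul_cancel x hx y hy h =>
    obtain ⟨i, j, hij, a, ha, rfl⟩ := hx
    rw [← steinbergX_neg]
    exact mul hij (-a) ha y hy h

theorem mem_rootSubgroup_univ (x : Steinberg e) : x ∈ rootSubgroup e Set.univ := by
  have h := PresentedGroup.closure_range_of {w : FreeGroup (SteinbergGen e) | SteinbergRel e w}
  have h' : (⊤ : Subgroup (Steinberg e)) ≤ rootSubgroup e Set.univ := by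
    rw [← h]
    refine Subgroup.closure_mono ?_
    rintro _ ⟨g, rfl⟩
    exact ⟨g.row, g.col, g.ne, g.val, trivial, rfl⟩
  exact h' trivial

/-- Conjugation either fixes a generator or adds a factor at the sum of the two roots, so it
suffices that `Ψ` absorbs the root `(i, j)`. The opposite root is excluded because no commutator
formula covers it. -/
theorem conj_mem_rootSubgroup {Ψ : Set (Fin n × Fin n)} {i j : Fin n} (hij : i ≠ j)
    (hopp : (j, i) ∉ Ψ) (hl : ∀ l, (j, l) ∈ Ψ → (i, l) ∈ Ψ) (hr : ∀ k, (k, i) ∈ Ψ → (k, j) ∈ Ψ)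
    (a : peirce e i j) {x : Steinberg e} (hx : x ∈ rootSubgroup e Ψ) :
    steinbergX e hij a * x * (steinbergX e hij a)⁻¹ ∈ rootSubgroup e Ψ := by
  refine rootSubgroup_induction (P := fun x =>
    steinbergX e hij a * x * (steinbergX e hij a)⁻¹ ∈ rootSubgroup e Ψ) ?_ ?_ hx
  · simp [one_mem]
  · intro k l hkl b hΨ y _ hy
    rw [show steinbergX e hij a * (steinbergX e hkl b * y) * (steinbergX e hij a)⁻¹ =
      (steinbergX e hij a * steinbergX e hkl b * (steinbergX e hij a)⁻¹) *
        (steinbergX e hij a * y * (steinbergX e hij a)⁻¹) by group]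
    refine mul_mem ?_ hy
    by_cases hjk : j = k
    · subst hjk
      by_cases hil : i = l
      · subst hil
        exact absurd hΨ hopp
      · rw [steinbergX_conj_left hij hkl hil]
        exact mul_mem (steinbergX_mem_rootSubgroup _ (hl _ hΨ) _)
          (steinbergX_mem_rootSubgroup _ hΨ _)
    · by_cases hil : i = l
      · subst hil
        rw [steinbergX_conj_right hij hkl (Ne.symm hjk)]
        exact mul_mem (steinbergX_mem_rootSubgroup _ (hr _ hΨ) _)
          (steinbergX_mem_rootSubgroup _ hΨ _)
      · rw [steinbergX_conj_comm hij hkl hjk hil]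
        exact steinbergX_mem_rootSubgroup _ hΨ _

theorem diagAct_mem_rootSubgroup (he : CompleteOrthogonalIdempotents e) (d : diagGroup he)
    {Ψ : Set (Fin n × Fin n)} {x : Steinberg e} (hx : x ∈ rootSubgroup e Ψ) :
    diagAct he d x ∈ rootSubgroup e Ψ := by
  refine rootSubgroup_induction (P := fun x => diagAct he d x ∈ rootSubgroup e Ψ) ?_ ?_ hx
  · simp [one_mem]
  · intro i j hij a hΨ y _ hy
    rw [map_mul, diagAct_x]
    exact mul_mem (steinbergX_mem_rootSubgroup _ hΨ _) hy

/-- A set of roots closed under addition and containing no opposite roots. -/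
structure IsUnipotentRootSet (Ψ : Set (Fin n × Fin n)) : Prop where
  irrefl : ∀ i, (i, i) ∉ Ψ
  trans : ∀ {i j k}, (i, j) ∈ Ψ → (j, k) ∈ Ψ → (i, k) ∈ Ψ

theorem IsUnipotentRootSet.asymm {Ψ : Set (Fin n × Fin n)} (hΨ : IsUnipotentRootSet Ψ)
    {i j : Fin n} (h : (i, j) ∈ Ψ) : (j, i) ∉ Ψ :=
  fun h' => hΨ.irrefl _ (hΨ.trans h h')

theorem IsUnipotentRootSet.ne {Ψ : Set (Fin n × Fin n)} (hΨ : IsUnipotentRootSet Ψ)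
    {i j : Fin n} (h : (i, j) ∈ Ψ) : i ≠ j := by
  rintro rfl
  exact hΨ.irrefl _ h

theorem IsUnipotentRootSet.conj_mem {Ψ : Set (Fin n × Fin n)} (hΨ : IsUnipotentRootSet Ψ)
    {i j : Fin n} (hij : i ≠ j) (h : (i, j) ∈ Ψ) (a : peirce e i j) {x : Steinberg e}
    (hx : x ∈ rootSubgroup e (Ψ \ {(i, j)})) :
    steinbergX e hij a * x * (steinbergX e hij a)⁻¹ ∈ rootSubgroup e (Ψ \ {(i, j)}) := by
  refine conj_mem_rootSubgroup hij (fun h' => hΨ.asymm h h'.1) (fun m hm => Set.mem_sdiff_singleton.2 ⟨hΨ.trans h hm.1, ?_⟩)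
    (fun m hm => Set.mem_sdiff_singleton.2 ⟨hΨ.trans hm.1 h, ?_⟩) a hx
  · intro h'
    obtain ⟨-, rfl⟩ := Prod.mk.inj h'
    exact hΨ.irrefl _ hm.1
  · intro h'
    obtain ⟨rfl, -⟩ := Prod.mk.inj h'
    exact hΨ.irrefl _ hm.1

/-- Splitting off one root subgroup. -/
theorem IsUnipotentRootSet.exists_mul_steinbergX {Ψ : Set (Fin n × Fin n)}
    (hΨ : IsUnipotentRootSet Ψ) {i j : Fin n} (hij : i ≠ j) (h : (i, j) ∈ Ψ)
    {x : Steinberg e} (hx : x ∈ rootSubgroup e Ψ) :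
    ∃ p ∈ rootSubgroup e (Ψ \ {(i, j)}), ∃ b : peirce e i j, x = p * steinbergX e hij b := by
  refine rootSubgroup_induction (P := fun x => ∃ p ∈ rootSubgroup e (Ψ \ {(i, j)}),
    ∃ b : peirce e i j, x = p * steinbergX e hij b) ?_ ?_ hx
  · exact ⟨1, one_mem _, 0, by rw [steinbergX_zero, one_mul]⟩
  · rintro k l hkl a hkl' _ - ⟨p, hp, b, rfl⟩
    by_cases h' : (k, l) = (i, j)
    · obtain ⟨rfl, rfl⟩ := Prod.mk.inj h'
      refine ⟨_, hΨ.conj_mem hkl h a hp, a + b, ?_⟩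
      rw [← steinbergX_add]
      group
    · exact ⟨_, mul_mem (steinbergX_mem_rootSubgroup hkl (Set.mem_sdiff_singleton.2 ⟨hkl', h'⟩) a) hp, b,
        (mul_assoc _ _ _).symm⟩

theorem IsUnipotentRootSet.exists_steinbergX_mul {Ψ : Set (Fin n × Fin n)}
    (hΨ : IsUnipotentRootSet Ψ) {i j : Fin n} (hij : i ≠ j) (h : (i, j) ∈ Ψ)
    {x : Steinberg e} (hx : x ∈ rootSubgroup e Ψ) :
    ∃ p ∈ rootSubgroup e (Ψ \ {(i, j)}), ∃ b : peirce e i j, x = steinbergX e hij b * p := by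
  obtain ⟨p, hp, b, hb⟩ := hΨ.exists_mul_steinbergX hij h (inv_mem hx)
  refine ⟨p⁻¹, inv_mem hp, -b, ?_⟩
  rw [steinbergX_neg, ← mul_inv_rev, ← hb, inv_inv]

/-- `Ψ` is a strict partial order on the indices, and the image consists of matrices unitriangular
for it. -/
theorem IsUnipotentRootSet.st_apply {Ψ : Set (Fin n × Fin n)} (hΨ : IsUnipotentRootSet Ψ)
    (he : OrthogonalIdempotents e) {x : Steinberg e} (hx : x ∈ rootSubgroup e Ψ) :
    (∀ i, e i * (st he x : R) * e i = e i) ∧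
      ∀ i j, i ≠ j → (i, j) ∉ Ψ → e i * (st he x : R) * e j = 0 := by
  refine rootSubgroup_induction (P := fun x => (∀ i, e i * (st he x : R) * e i = e i) ∧
      ∀ i j, i ≠ j → (i, j) ∉ Ψ → e i * (st he x : R) * e j = 0) ?_ ?_ hx
  · refine ⟨fun i => by simp [(he.idem i).eq], fun i j hij _ => ?_⟩
    have h : e i * e j = 0 := he.ortho hij
    simp [h]
  · rintro k l hkl a hkl' y - ⟨hy₁, hy₂⟩
    have key : ∀ i j, e i * (st he (steinbergX e hkl a * y) : R) * e j =
        e i * (st he y : R) * e j + e i * a * (e l * (st he y : R) * e j) := by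
      intro i j
      rw [map_mul, Units.val_mul, st_x_val]
      nth_rewrite 1 [← peirce_right he a]
      noncomm_ring
    refine ⟨fun i => ?_, fun i j hij hij' => ?_⟩
    · rw [key, hy₁]
      by_cases h : i = k
      · subst h
        rw [hy₂ l i hkl.symm (hΨ.asymm hkl'), mul_zero, add_zero]
      · rw [idem_mul_peirce he h, zero_mul, add_zero]
    · rw [key, hy₂ i j hij hij']
      by_cases h : i = k
      · subst h
        by_cases hlj : l = j
        · subst hlj
          exact absurd hkl' hij'
        · rw [hy₂ l j hlj (fun h' => hij' (hΨ.trans hkl' h')), mul_zero, add_zero]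
      · rw [idem_mul_peirce he h, zero_mul, add_zero]

/-- Take a root with the fewest intermediate indices: if it decomposed through `k`, then `(i, k)`
would have fewer. Deleting an indecomposable root leaves a unipotent root set, which drives the
induction on the size of `Ψ`. -/
theorem IsUnipotentRootSet.exists_simple {Ψ : Set (Fin n × Fin n)} (hΨ : IsUnipotentRootSet Ψ)
    (hne : Ψ.Nonempty) : ∃ i j, (i, j) ∈ Ψ ∧ ∀ k, (i, k) ∈ Ψ → (k, j) ∉ Ψ := by
  obtain ⟨⟨i, j⟩, hij, hmin⟩ := Set.exists_min_image Ψ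
    (fun p => {k | (p.1, k) ∈ Ψ ∧ (k, p.2) ∈ Ψ}.ncard) (Set.toFinite _) hne
  refine ⟨i, j, hij, fun k hik hkj => ?_⟩
  refine (hmin (i, k) hik).not_gt (Set.ncard_lt_ncard ?_ (Set.toFinite _))
  have hsub : {l | (i, l) ∈ Ψ ∧ (l, k) ∈ Ψ} ⊆ {l | (i, l) ∈ Ψ ∧ (l, j) ∈ Ψ} :=
    fun l hl => And.intro hl.1 (hΨ.trans hl.2 hkj)
  exact (Set.ssubset_iff_of_subset hsub).2 ⟨k, And.intro hik hkj, fun h => hΨ.irrefl _ h.2⟩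

/-- The homomorphism `st` is injective on the unipotent subgroups. -/
theorem IsUnipotentRootSet.eq_one_of_st_eq_one {Ψ : Set (Fin n × Fin n)}
    (hΨ : IsUnipotentRootSet Ψ) (he : OrthogonalIdempotents e) {x : Steinberg e}
    (hx : x ∈ rootSubgroup e Ψ) (h : st he x = 1) : x = 1 := by
  induction hm : Ψ.ncard generalizing Ψ x with
  | zero =>
    have h0 : Ψ = ∅ := (Set.ncard_eq_zero (Set.toFinite _)).1 hm
    subst h0
    exact rootSubgroup_induction (P := fun x => x = 1) rfl (fun _ _ h => h.elim) hx
  | succ m ih =>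
    obtain ⟨i, j, hij, hs⟩ := hΨ.exists_simple
      (Set.nonempty_of_ncard_ne_zero (by rw [hm]; exact m.succ_ne_zero))
    have hne := hΨ.ne hij
    have hΨ' : IsUnipotentRootSet (Ψ \ {(i, j)}) := by
      refine ⟨fun k hk => hΨ.irrefl k hk.1,
        fun {a b c} hab hbc => Set.mem_sdiff_singleton.2 ⟨hΨ.trans hab.1 hbc.1, ?_⟩⟩
      intro h'
      obtain ⟨rfl, rfl⟩ := Prod.mk.inj h'
      exact hs b hab.1 hbc.1
    obtain ⟨p, hp, b, rfl⟩ := hΨ.exists_mul_steinbergX hne hij hx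
    obtain ⟨h₁, h₂⟩ := hΨ'.st_apply he hp
    -- The deleted root contributes nothing to the `(i, j)` entry of `st p`, so that entry of the
    -- product is exactly `b`.
    have hb : (b : R) = 0 := by
      have hb' : e i * (st he (p * steinbergX e hne b) : R) * e j = b := by
        rw [map_mul, Units.val_mul, st_x_val]
        calc e i * ((st he p : R) * (1 + b)) * e j
            = e i * (st he p : R) * e j + e i * (st he p : R) * b * e j := by noncomm_ring
          _ = e i * (st he p : R) * e i * (b * e j) := by
            rw [h₂ i j hne (fun h' => h'.2 rfl), zero_add]
            nth_rewrite 1 [← peirce_left he b]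
            noncomm_ring
          _ = b := by rw [h₁, peirce_right he, peirce_left he]
      have hij0 : e i * e j = 0 := he.ortho hne
      rw [← hb', h, Units.val_one, mul_one, hij0]
    obtain rfl : b = 0 := Subtype.ext hb
    rw [steinbergX_zero, mul_one] at h ⊢
    have hm' : (Ψ \ {(i, j)}).ncard = m := by
      rw [Set.ncard_sdiff_singleton_of_mem hij, hm]
      rfl
    exact ih hΨ' hp h hm'

end Steinberg

/-! ### Rank one subgroups: their action on `St(R)` and their Gauss decomposition. -/

section RankOne

variable {R : Type u} [Ring R] {n : ℕ} {e : Fin n → R}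

theorem peirceProj_of_ne (he : OrthogonalIdempotents e) {i j k : Fin n} (hjk : j ≠ k)
    (a : peirce e i j) : peirceProj e i k (a : R) = 0 :=
  Subtype.ext (by
    change e i * (a : R) * e k = 0
    rw [mul_assoc, peirce_mul_idem he hjk, mul_zero])

theorem peirceProj_of_ne' (he : OrthogonalIdempotents e) {i j k : Fin n} (hki : k ≠ i)
    (a : peirce e i j) : peirceProj e k j (a : R) = 0 :=
  Subtype.ext (by
    change e k * (a : R) * e j = 0
    rw [idem_mul_peirce he hki, zero_mul])

/-- The element of the Steinberg group with the components `e_k r e_i` and `e_k r e_j`. -/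
def rowX (e : Fin n → R) {i j k : Fin n} (hki : k ≠ i) (hkj : k ≠ j) (r : R) : Steinberg e :=
  steinbergX e hki (peirceProj e k i r) * steinbergX e hkj (peirceProj e k j r)

/-- The element of the Steinberg group with the components `e_i r e_k` and `e_j r e_k`. -/
def colX (e : Fin n → R) {i j k : Fin n} (hik : i ≠ k) (hjk : j ≠ k) (r : R) : Steinberg e :=
  steinbergX e hik (peirceProj e i k r) * steinbergX e hjk (peirceProj e j k r)

theorem rowX_swap {i j k : Fin n} (hki : k ≠ i) (hkj : k ≠ j) (r : R) :
    rowX e hki hkj r = rowX e hkj hki r :=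
  steinbergX_commute hki hkj hki.symm hkj _ _

theorem colX_swap {i j k : Fin n} (hik : i ≠ k) (hjk : j ≠ k) (r : R) :
    colX e hik hjk r = colX e hjk hik r :=
  steinbergX_commute hik hjk hjk.symm hik _ _

theorem rowX_coe (he : OrthogonalIdempotents e) {i j k : Fin n} (hij : i ≠ j) (hki : k ≠ i)
    (hkj : k ≠ j) (a : peirce e k i) : rowX e hki hkj (a : R) = steinbergX e hki a := by
  rw [rowX, peirceProj_coe he, peirceProj_of_ne he hij, steinbergX_zero, mul_one]

theorem colX_coe (he : OrthogonalIdempotents e) {i j k : Fin n} (hij : i ≠ j) (hik : i ≠ k)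
    (hjk : j ≠ k) (a : peirce e i k) : colX e hik hjk (a : R) = steinbergX e hik a := by
  rw [colX, peirceProj_coe he, peirceProj_of_ne' he hij.symm, steinbergX_zero, mul_one]

theorem conj_rowX (he : OrthogonalIdempotents e) {i j k : Fin n} (hij : i ≠ j) (hki : k ≠ i)
    (hkj : k ≠ j) (c : peirce e i j) (r : R) :
    steinbergX e hij c * rowX e hki hkj r * (steinbergX e hij c)⁻¹ =
      rowX e hki hkj (r * (1 - c)) := by
  have h₁ : peirceProj e k i (r * (1 - c)) = peirceProj e k i r := Subtype.ext (by
    change e k * (r * (1 - c)) * e i = e k * r * e i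
    have h := peirce_mul_idem he hij.symm c
    calc e k * (r * (1 - c)) * e i = e k * r * e i - e k * r * (c * e i) := by noncomm_ring
      _ = _ := by rw [h, mul_zero, sub_zero])
  have h₂ : peirceProj e k j (r * (1 - c)) =
      peirceProj e k j r + -peirceMul (peirceProj e k i r) c := Subtype.ext (by
    change e k * (r * (1 - c)) * e j = e k * r * e j + -(e k * r * e i * c)
    calc e k * (r * (1 - c)) * e j = e k * r * e j - e k * r * (c * e j) := by noncomm_ring
      _ = _ := by
        rw [peirce_right he, mul_assoc _ (e i), peirce_left he]
        abel)
  have h₃ := steinbergX_conj_right hij hki hkj c (peirceProj e k i r)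
  have h₄ := steinbergX_conj_comm hij hkj hkj.symm hij c (peirceProj e k j r)
  rw [rowX, rowX, h₁, h₂, add_comm, ← steinbergX_add, ← conj_mul, h₃, h₄,
    steinbergX_commute hkj hki hkj.symm hki, mul_assoc]

theorem conj_colX (he : OrthogonalIdempotents e) {i j k : Fin n} (hij : i ≠ j) (hik : i ≠ k)
    (hjk : j ≠ k) (c : peirce e i j) (r : R) :
    steinbergX e hij c * colX e hik hjk r * (steinbergX e hij c)⁻¹ =
      colX e hik hjk ((1 + c) * r) := by
  have h₁ : peirceProj e j k ((1 + c) * r) = peirceProj e j k r := Subtype.ext (by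
    change e j * ((1 + c) * r) * e k = e j * r * e k
    have h := idem_mul_peirce he hij.symm c
    calc e j * ((1 + c) * r) * e k = e j * r * e k + e j * c * r * e k := by noncomm_ring
      _ = _ := by rw [h, zero_mul, zero_mul, add_zero])
  have h₂ : peirceProj e i k ((1 + c) * r) =
      peirceProj e i k r + peirceMul c (peirceProj e j k r) := Subtype.ext (by
    change e i * ((1 + c) * r) * e k = e i * r * e k + c * (e j * r * e k)
    calc e i * ((1 + c) * r) * e k = e i * r * e k + e i * c * r * e k := by noncomm_ring
      _ = e i * r * e k + c * e j * r * e k := by rw [peirce_right he, peirce_left he]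
      _ = _ := by simp only [mul_assoc])
  have h₃ := steinbergX_conj_left hij hjk hik c (peirceProj e j k r)
  have h₄ := steinbergX_conj_comm hij hik hij.symm hik c (peirceProj e i k r)
  rw [colX, colX, h₁, h₂, ← steinbergX_add, ← conj_mul, h₃, h₄, mul_assoc]

variable {i j : Fin n}

/-- The elements `rowX` form a copy of the row module `R_ki ⊕ R_kj`. The point is that the action of
`w` on it depends only on `st w`; `rank_one_conj_colX` is the dual statement for columns. -/
theorem rank_one_conj_rowX (he : OrthogonalIdempotents e) {k : Fin n} (hki : k ≠ i)
    (hkj : k ≠ j) {w : Steinberg e} (hw : w ∈ rootSubgroup e {(i, j), (j, i)}) (r : R) :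
    w * rowX e hki hkj r * w⁻¹ = rowX e hki hkj (r * ((st he w)⁻¹ : Rˣ)) := by
  refine rootSubgroup_induction (P := fun w => ∀ r, w * rowX e hki hkj r * w⁻¹ =
    rowX e hki hkj (r * ((st he w)⁻¹ : Rˣ))) ?_ ?_ hw r
  · simp
  · intro k l hkl a hΨ y _ hy r
    have h : steinbergX e hkl a * y * rowX e hki hkj r * (steinbergX e hkl a * y)⁻¹ =
        steinbergX e hkl a * (y * rowX e hki hkj r * y⁻¹) * (steinbergX e hkl a)⁻¹ := by
      group
    rw [h, hy, map_mul, mul_inv_rev, Units.val_mul, st_x_inv_val, ← mul_assoc r]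
    rcases hΨ with hΨ | hΨ
    · obtain ⟨rfl, rfl⟩ := Prod.mk.inj hΨ
      exact conj_rowX he hkl hki hkj a _
    · obtain ⟨rfl, rfl⟩ := Prod.mk.inj hΨ
      rw [rowX_swap, rowX_swap hki]
      exact conj_rowX he hkl hkj hki a _

theorem rank_one_conj_colX (he : OrthogonalIdempotents e) {k : Fin n} (hik : i ≠ k)
    (hjk : j ≠ k) {w : Steinberg e} (hw : w ∈ rootSubgroup e {(i, j), (j, i)}) (r : R) :
    w * colX e hik hjk r * w⁻¹ = colX e hik hjk (st he w * r) := by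
  refine rootSubgroup_induction (P := fun w => ∀ r, w * colX e hik hjk r * w⁻¹ =
    colX e hik hjk (st he w * r)) ?_ ?_ hw r
  · simp
  · intro k l hkl a hΨ y _ hy r
    have h : steinbergX e hkl a * y * colX e hik hjk r * (steinbergX e hkl a * y)⁻¹ =
        steinbergX e hkl a * (y * colX e hik hjk r * y⁻¹) * (steinbergX e hkl a)⁻¹ := by
      group
    rw [h, hy, map_mul, Units.val_mul, st_x_val, mul_assoc (1 + (a : R))]
    rcases hΨ with hΨ | hΨ
    · obtain ⟨rfl, rfl⟩ := Prod.mk.inj hΨ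
      exact conj_colX he hkl hik hjk a _
    · obtain ⟨rfl, rfl⟩ := Prod.mk.inj hΨ
      rw [colX_swap, colX_swap hik]
      exact conj_colX he hkl hjk hik a _

theorem rank_one_st_mul_idem (he : OrthogonalIdempotents e) {k : Fin n} (hki : k ≠ i)
    (hkj : k ≠ j) {w : Steinberg e} (hw : w ∈ rootSubgroup e {(i, j), (j, i)}) :
    (st he w : R) * e k = e k ∧ e k * (st he w : R) = e k := by
  refine rootSubgroup_induction (P := fun w =>
    (st he w : R) * e k = e k ∧ e k * (st he w : R) = e k) (by simp) ?_ hw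
  rintro a b hab c hΨ y - ⟨h₁, h₂⟩
  have h : b ≠ k ∧ k ≠ a := by
    rcases hΨ with hΨ | hΨ <;> obtain ⟨rfl, rfl⟩ := Prod.mk.inj hΨ
    exacts [⟨hkj.symm, hki⟩, ⟨hki.symm, hkj⟩]
  rw [map_mul, Units.val_mul, st_x_val, mul_assoc, h₁, ← mul_assoc, add_mul, mul_add, one_mul,
    mul_one, peirce_mul_idem he h.1, idem_mul_peirce he h.2, add_zero, h₂]
  exact ⟨rfl, rfl⟩

theorem rank_one_commute (he : OrthogonalIdempotents e) {w : Steinberg e}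
    (hw : w ∈ rootSubgroup e {(i, j), (j, i)}) : Commute (st he w : R) (e i + e j) := by
  refine rootSubgroup_induction (P := fun w => Commute (st he w : R) (e i + e j)) (by simp) ?_ hw
  rintro a b hab c hΨ y - h
  rw [map_mul, Units.val_mul, st_x_val]
  refine Commute.mul_left ((Commute.one_left _).add_left ?_) h
  have h₁ := peirce_left he c
  have h₂ := peirce_right he c
  have h₃ := idem_mul_peirce he hab.symm c
  have h₄ := peirce_mul_idem he hab.symm c
  change (c : R) * _ = _ * (c : R)
  rcases hΨ with hΨ | hΨ <;> obtain ⟨rfl, rfl⟩ := Prod.mk.inj hΨ <;>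
    simp [mul_add, add_mul, h₁, h₂, h₃, h₄]

/-- The map from `St(R)` to automorphisms of `St(R)` and to `GL(R)`. -/
def steinbergPair (he : OrthogonalIdempotents e) : Steinberg e →* MulAut (Steinberg e) × Rˣ :=
  MulAut.conj.prod (st he)

/-- The map from `D(R)` to automorphisms of `St(R)` and to `GL(R)`. -/
def diagPair (he : CompleteOrthogonalIdempotents e) :
    diagGroup he →* MulAut (Steinberg e) × Rˣ :=
  (diagAct he).prod (diagGroup he).subtype

/-- The semidirect product relation, used to collect diagonal factors on the right. -/
theorem diagPair_mul_steinbergPair (he : CompleteOrthogonalIdempotents e) (d : diagGroup he)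
    (x : Steinberg e) :
    diagPair he d * steinbergPair he.toOrthogonalIdempotents x =
      steinbergPair he.toOrthogonalIdempotents (diagAct he d x) * diagPair he d := by
  refine Prod.ext ?_ ?_
  · ext y
    simp [diagPair, steinbergPair]
  · change (d : Rˣ) * st _ x = st _ (diagAct he d x) * (d : Rˣ)
    rw [st_diagAct, inv_mul_cancel_right]

/-- As `d` is trivial at the index `k`, it acts on `R_ki` as right multiplication by `d⁻¹` and on
`R_ik` as left multiplication by `d`; both are undone by `w`, whose matrix is `d⁻¹`. -/
theorem rank_one_fixes (he : CompleteOrthogonalIdempotents e) {k : Fin n} (hij : i ≠ j)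
    (hki : k ≠ i) (hkj : k ≠ j) {w : Steinberg e} (hw : w ∈ rootSubgroup e {(i, j), (j, i)})
    {d : diagGroup he} (hd : st he.toOrthogonalIdempotents w * d = 1) :
    (∀ a : peirce e k i, w * diagAct he d (steinbergX e hki a) * w⁻¹ = steinbergX e hki a) ∧
      ∀ a : peirce e i k, w * diagAct he d (steinbergX e hki.symm a) * w⁻¹ =
        steinbergX e hki.symm a := by
  have he' := he.toOrthogonalIdempotents
  obtain ⟨h₁, h₂⟩ := rank_one_st_mul_idem he' hki hkj hw
  have hst : st he' w = (d : Rˣ)⁻¹ := eq_inv_of_mul_eq_one_left hd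
  have hde : ((d : Rˣ) : R) * e k = e k := by
    rw [hst, Units.inv_mul_eq_iff_eq_mul] at h₁
    exact h₁.symm
  have hed : e k * (((d : Rˣ)⁻¹ : Rˣ) : R) = e k := by rw [← hst, h₂]
  constructor <;> intro a
  · have hc : ((diagConj he d a : peirce e k i) : R) = (a : R) * (((d : Rˣ)⁻¹ : Rˣ) : R) := by
      change ((d : Rˣ) : R) * (a : R) * (((d : Rˣ)⁻¹ : Rˣ) : R) = _
      nth_rewrite 1 [← peirce_left he' a]
      rw [← mul_assoc ((d : Rˣ) : R), hde, peirce_left he']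
    rw [diagAct_x, ← rowX_coe he' hij hki hkj, ← rowX_coe he' hij hki hkj,
      rank_one_conj_rowX he' hki hkj hw, hst, inv_inv, hc, Units.inv_mul_cancel_right]
  · have hc : ((diagConj he d a : peirce e i k) : R) = ((d : Rˣ) : R) * (a : R) := by
      change ((d : Rˣ) : R) * (a : R) * (((d : Rˣ)⁻¹ : Rˣ) : R) = _
      nth_rewrite 1 [← peirce_right he' a]
      rw [mul_assoc, mul_assoc, hed, peirce_right he']
    rw [diagAct_x, ← colX_coe he' hij hki.symm hkj.symm, ← colX_coe he' hij hki.symm hkj.symm,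
      rank_one_conj_colX he' hki.symm hkj.symm hw, hst, hc, Units.inv_mul_cancel_left]

/-- An automorphism fixing `x_ik` and `x_kj` fixes `x_ij`. -/
theorem fixes_of_fixes (he : OrthogonalIdempotents e) (hM : ∀ i j, MoritaEquivalent (e i) (e j))
    (f : Steinberg e →* Steinberg e) {k : Fin n} (hij : i ≠ j) (hik : i ≠ k) (hkj : k ≠ j)
    (h₁ : ∀ a : peirce e i k, f (steinbergX e hik a) = steinbergX e hik a)
    (h₂ : ∀ a : peirce e k j, f (steinbergX e hkj a) = steinbergX e hkj a) (a : peirce e i j) :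
    f (steinbergX e hij a) = steinbergX e hij a := by
  refine peirce_induction he (hM k i).1 (P := fun a => f (steinbergX e hij a) = steinbergX e hij a)
    ?_ ?_ ?_ ?_ a
  · intro b c
    rw [← steinbergX_mul hik hkj hij, map_commutatorElement, h₁, h₂]
  · rw [steinbergX_zero, map_one]
  · intro a b ha hb
    rw [← steinbergX_add, map_mul, ha, hb]
  · intro a ha
    rw [steinbergX_neg, map_inv, ha]

theorem exists_ne_ne (hn : 3 ≤ n) (i j : Fin n) : ∃ m : Fin n, m ≠ i ∧ m ≠ j := by
  have h : ({i, j} : Finset (Fin n)) ≠ Finset.univ := by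
    intro h
    have h' := Finset.card_le_two (a := i) (b := j)
    rw [h, Finset.card_univ, Fintype.card_fin] at h'
    omega
  obtain ⟨m, hm⟩ : ∃ m, m ∉ ({i, j} : Finset (Fin n)) := by
    by_contra! h'
    exact h (Finset.eq_univ_of_forall h')
  exact ⟨m, by simpa using hm⟩

/-- An element of a rank one subgroup acts on `St(R)` through its image in `GL(R)`. -/
theorem rank_one_eq_one (hn : 3 ≤ n) (he : CompleteOrthogonalIdempotents e)
    (hM : ∀ i j, MoritaEquivalent (e i) (e j)) (hij : i ≠ j)
    {w : Steinberg e} (hw : w ∈ rootSubgroup e {(i, j), (j, i)}) {d : diagGroup he}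
    (hd : st he.toOrthogonalIdempotents w * d = 1) :
    steinbergPair he.toOrthogonalIdempotents w * diagPair he d = 1 := by
  have he' := he.toOrthogonalIdempotents
  have hw' : w ∈ rootSubgroup e {(j, i), (i, j)} := by rwa [Set.pair_comm]
  let f : Steinberg e →* Steinberg e := (MulAut.conj w * diagAct he d).toMonoidHom
  have hf : ∀ x, f x = w * diagAct he d x * w⁻¹ := fun x => rfl
  have hi : ∀ k (hki : k ≠ i), k ≠ j →
      (∀ a : peirce e k i, f (steinbergX e hki a) = steinbergX e hki a) ∧
      ∀ a : peirce e i k, f (steinbergX e hki.symm a) = steinbergX e hki.symm a :=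
    fun k hki hkj => rank_one_fixes he hij hki hkj hw hd
  have hj : ∀ k (hkj : k ≠ j), k ≠ i →
      (∀ a : peirce e k j, f (steinbergX e hkj a) = steinbergX e hkj a) ∧
      ∀ a : peirce e j k, f (steinbergX e hkj.symm a) = steinbergX e hkj.symm a :=
    fun k hkj hki => rank_one_fixes he hij.symm hkj hki hw' hd
  obtain ⟨m, hmi, hmj⟩ := exists_ne_ne hn i j
  -- Roots sharing exactly one index with `{i, j}` are covered by `hi` and `hj`. The roots `(i, j)`
  -- and `(j, i)` factor through the third index `m`, and roots disjoint from `{i, j}` factor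
  -- through `i`.
  have hfid : f = MonoidHom.id _ := by
    refine steinberg_hom_ext fun {k l} hkl a => ?_
    rw [MonoidHom.id_apply]
    by_cases hki : k = i
    · subst hki
      by_cases hlj : l = j
      · subst hlj
        exact fixes_of_fixes he' hM f hkl hmi.symm hmj (hi m hmi hmj).2 (hj m hmj hmi).1 a
      · exact (hi l hkl.symm hlj).2 a
    by_cases hkj : k = j
    · subst hkj
      by_cases hli : l = i
      · subst hli
        exact fixes_of_fixes he' hM f hkl hmj.symm hmi (hj m hmj hmi).2 (hi m hmi hmj).1 a
      · exact (hj l hkl.symm hli).2 a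
    by_cases hli : l = i
    · subst hli
      exact (hi k hki hkj).1 a
    by_cases hlj : l = j
    · subst hlj
      exact (hj k hkj hki).1 a
    exact fixes_of_fixes he' hM f hkl hki (Ne.symm hli) (hi k hki hkj).1 (hi l hli hlj).2 a
  refine Prod.ext ?_ hd
  ext x
  exact DFunLike.congr_fun hfid x

theorem mem_diagGroup_of_commute (he : CompleteOrthogonalIdempotents e) {g : Rˣ}
    (h : ∀ i, Commute (g : R) (e i)) : g ∈ diagGroup he := by
  intro i j hij
  have hij0 : e i * e j = 0 := he.ortho hij
  rw [mul_assoc, (h j).eq, ← mul_assoc, hij0, zero_mul]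

/-- Gauss decomposition in rank one. -/
theorem rank_one_decomposition (hR : HasStableRankOne R) (hn : 3 ≤ n)
    (he : CompleteOrthogonalIdempotents e) (hM : ∀ i j, MoritaEquivalent (e i) (e j)) (hij : i ≠ j)
    {w : Steinberg e} (hw : w ∈ rootSubgroup e {(i, j), (j, i)}) :
    ∃ (p : peirce e i j) (q : peirce e j i) (r : peirce e i j) (d : diagGroup he),
      steinbergPair he.toOrthogonalIdempotents w = steinbergPair he.toOrthogonalIdempotents
        (steinbergX e hij p * steinbergX e hij.symm q * steinbergX e hij r) * diagPair he d := by
  have he' := he.toOrthogonalIdempotents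
  have hij0 : e i * e j = 0 := he.ortho hij
  have hji0 : e j * e i = 0 := he.ortho hij.symm
  obtain ⟨p, q, r, ⟨hp₁, hp₂⟩, ⟨hq₁, hq₂⟩, ⟨hr₁, hr₂⟩, hi, hj, hk⟩ :=
    hR.exists_block_diagonal (he.idem i).eq (he.idem j).eq hij0 hji0 (st he' w)
      (rank_one_commute he' hw)
  lift p to peirce e i j using ⟨p, by rw [hp₁, hp₂]⟩
  lift q to peirce e j i using ⟨q, by rw [hq₁, hq₂]⟩
  lift r to peirce e i j using ⟨r, by rw [hr₁, hr₂]⟩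
  obtain ⟨y, hy⟩ : ∃ y, y = steinbergX e hij.symm q * steinbergX e hij p * w * steinbergX e hij r :=
    ⟨_, rfl⟩
  have hst : (st he' y : R) = (1 + q) * (1 + p) * st he' w * (1 + r) := by
    simp only [hy, map_mul, Units.val_mul, st_x_val]
  have hyd : st he' y ∈ diagGroup he := by
    refine mem_diagGroup_of_commute he fun k => ?_
    rw [hst]
    by_cases hki : k = i
    · rwa [hki]
    by_cases hkj : k = j
    · rwa [hkj]
    obtain ⟨h₁, h₂⟩ := rank_one_st_mul_idem he' hki hkj hw
    exact hk _ (he.ortho hki) (he.ortho (Ne.symm hki)) (he.ortho hkj) (he.ortho (Ne.symm hkj))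
      (h₁.trans h₂.symm)
  have hyw : y ∈ rootSubgroup e {(i, j), (j, i)} := by
    rw [hy]
    exact mul_mem (mul_mem (mul_mem (steinbergX_mem_rootSubgroup _ (by simp) _)
      (steinbergX_mem_rootSubgroup _ (by simp) _)) hw) (steinbergX_mem_rootSubgroup _ (by simp) _)
  obtain ⟨d, hd⟩ : ∃ d : diagGroup he, d = ⟨st he' y, hyd⟩ := ⟨_, rfl⟩
  have hone := rank_one_eq_one hn he hM hij hyw (d := d⁻¹) (by rw [hd]; simp)
  rw [map_inv, mul_inv_eq_one] at hone
  -- Solve the definition of `y` for `w` and replace `y` by `d`; moving `d` to the right past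
  -- `x_ij(-r)` conjugates its argument.
  refine ⟨-p, -q, diagConj he d (-r), d, ?_⟩
  rw [map_mul _ _ (steinbergX e hij (diagConj he d (-r))), mul_assoc, ← diagAct_x,
    ← diagPair_mul_steinbergPair, ← hone, ← map_mul, ← map_mul, hy]
  simp only [steinbergX_neg]
  congr 1
  group

end RankOne

/-! ### Gauss decomposition of `St(R)` and the kernel of `St(R) ⋊ D(R) → GL(R)`. -/

section Gauss

variable {R : Type u} [Ring R] {n : ℕ} {e : Fin n → R}

/-- The positive roots. -/
def posRoots (n : ℕ) : Set (Fin n × Fin n) := {p | p.1 < p.2}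

/-- The negative roots. -/
def negRoots (n : ℕ) : Set (Fin n × Fin n) := {p | p.2 < p.1}

theorem isUnipotentRootSet_posRoots (n : ℕ) : IsUnipotentRootSet (posRoots n) :=
  ⟨fun i => lt_irrefl i, fun h h' => lt_trans (α := Fin n) h h'⟩

theorem isUnipotentRootSet_negRoots (n : ℕ) : IsUnipotentRootSet (negRoots n) :=
  ⟨fun i => lt_irrefl i, fun h h' => lt_trans (α := Fin n) h' h⟩

/-- `x` has a Gauss decomposition `U⁺ U⁻ U⁺ D` up to the kernel of the action on `St(R)`. -/
def HasGauss (he : CompleteOrthogonalIdempotents e) (x : Steinberg e) : Prop :=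
  ∃ u ∈ rootSubgroup e (posRoots n), ∃ v ∈ rootSubgroup e (negRoots n),
    ∃ u' ∈ rootSubgroup e (posRoots n), ∃ d : diagGroup he,
      steinbergPair he.toOrthogonalIdempotents x =
        steinbergPair he.toOrthogonalIdempotents (u * v * u') * diagPair he d

/-- Write `u = p x_ji(b)` and `v = x_ij(c) q`. Because `(j, i)` is simple, the other positive roots
absorb `(i, j)`, so `x_ij(a)` moves past `p` and meets `x_ji(b) x_ij(c)`. The rank one decomposition
of this product is taken with outer factors at `(j, i)`; its last factors `x_ji(r₀)` and `d₀` move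
past `q`, since the other negative roots absorb `(j, i)`. -/
theorem hasGauss_mul_of_simple (hR : HasStableRankOne R) (hn : 3 ≤ n)
    (he : CompleteOrthogonalIdempotents e) (hM : ∀ i j, MoritaEquivalent (e i) (e j))
    {i j : Fin n} (hij : i ≠ j) (hsucc : (i : ℕ) = j + 1) (a : peirce e i j) {y : Steinberg e}
    (hy : HasGauss he y) : HasGauss he (steinbergX e hij a * y) := by
  obtain ⟨u, hu, v, hv, u', hu', d, hd⟩ := hy
  have hpos : (j, i) ∈ posRoots n := Fin.lt_def.2 (by simp only; omega)
  have hneg : (i, j) ∈ negRoots n := hpos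
  obtain ⟨p, hp, b, rfl⟩ :=
    (isUnipotentRootSet_posRoots n).exists_mul_steinbergX hij.symm hpos hu
  obtain ⟨q, hq, c, rfl⟩ := (isUnipotentRootSet_negRoots n).exists_steinbergX_mul hij hneg hv
  have hp' : steinbergX e hij a * p * (steinbergX e hij a)⁻¹ ∈
      rootSubgroup e (posRoots n \ {(j, i)}) := by
    refine conj_mem_rootSubgroup hij (fun h => h.2 rfl) ?_ ?_ a hp
    · rintro l ⟨h₁, h₂⟩
      have h₁' : j < l := h₁
      have h₂' : l ≠ i := fun h => h₂ (by rw [h]; rfl)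
      have h : i < l := by
        rw [Fin.lt_def] at h₁' ⊢
        rw [Ne, Fin.ext_iff] at h₂'
        omega
      exact ⟨h, fun h' => hij (Prod.mk.inj h').1⟩
    · rintro k ⟨h₁, h₂⟩
      have h₁' : k < i := h₁
      have h₂' : k ≠ j := fun h => h₂ (by rw [h]; rfl)
      have h : k < j := by
        rw [Fin.lt_def] at h₁' ⊢
        rw [Ne, Fin.ext_iff] at h₂'
        omega
      exact ⟨h, fun h' => hij (Prod.mk.inj h').2.symm⟩
  obtain ⟨p₀, q₀, r₀, d₀, hw⟩ := rank_one_decomposition hR hn he hM hij.symm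
    (w := steinbergX e hij a * steinbergX e hij.symm b * steinbergX e hij c)
    (mul_mem (mul_mem (steinbergX_mem_rootSubgroup _ (by simp) _)
      (steinbergX_mem_rootSubgroup _ (by simp) _)) (steinbergX_mem_rootSubgroup _ (by simp) _))
  have hq' : steinbergX e hij.symm r₀ * diagAct he d₀ q * (steinbergX e hij.symm r₀)⁻¹ ∈
      rootSubgroup e (negRoots n \ {(i, j)}) := by
    refine conj_mem_rootSubgroup hij.symm (fun h => h.2 rfl) ?_ ?_ r₀
      (diagAct_mem_rootSubgroup he d₀ hq)
    · rintro l ⟨h₁, h₂⟩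
      have h₁' : l < i := h₁
      have h₂' : l ≠ j := fun h => h₂ (by rw [h]; rfl)
      have h : l < j := by
        rw [Fin.lt_def] at h₁' ⊢
        rw [Ne, Fin.ext_iff] at h₂'
        omega
      exact ⟨h, fun h' => hij (Prod.mk.inj h').1.symm⟩
    · rintro k ⟨h₁, h₂⟩
      have h₁' : j < k := h₁
      have h₂' : k ≠ i := fun h => h₂ (by rw [h]; rfl)
      have h : i < k := by
        rw [Fin.lt_def] at h₁' ⊢
        rw [Ne, Fin.ext_iff] at h₂'
        omega
      exact ⟨h, fun h' => hij (Prod.mk.inj h').2⟩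
  have hmono : ∀ {Ψ : Set (Fin n × Fin n)} {r} {x}, x ∈ rootSubgroup e (Ψ \ {r}) →
      x ∈ rootSubgroup e Ψ := by
    intro Ψ r x hx
    refine Subgroup.closure_mono ?_ hx
    rintro _ ⟨k, l, hkl, a, h, rfl⟩
    exact ⟨k, l, hkl, a, h.1, rfl⟩
  refine ⟨_, mul_mem (hmono hp') (steinbergX_mem_rootSubgroup hij.symm hpos p₀),
    _, mul_mem (steinbergX_mem_rootSubgroup hij hneg q₀) (hmono hq'),
    _, mul_mem (steinbergX_mem_rootSubgroup hij.symm hpos r₀)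
      (diagAct_mem_rootSubgroup he d₀ hu'), d₀ * d, ?_⟩
  have h₁ : steinbergPair he.toOrthogonalIdempotents (steinbergX e hij a * y) =
      steinbergPair he.toOrthogonalIdempotents
        (steinbergX e hij a * p * (steinbergX e hij a)⁻¹) *
      steinbergPair he.toOrthogonalIdempotents
        (steinbergX e hij a * steinbergX e hij.symm b * steinbergX e hij c) *
      steinbergPair he.toOrthogonalIdempotents (q * u') * diagPair he d := by
    rw [map_mul, hd]
    simp only [map_mul, map_inv]
    group
  rw [h₁, hw, mul_assoc _ (_ * diagPair he d₀), mul_assoc _ (diagPair he d₀),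
    diagPair_mul_steinbergPair]
  simp only [map_mul, map_inv]
  group

theorem hasGauss_mul_of_pos (he : CompleteOrthogonalIdempotents e) {i j : Fin n} (hij : i ≠ j)
    (h : i < j) (a : peirce e i j) {y : Steinberg e} (hy : HasGauss he y) :
    HasGauss he (steinbergX e hij a * y) := by
  obtain ⟨u, hu, v, hv, u', hu', d, hd⟩ := hy
  refine ⟨_, mul_mem (steinbergX_mem_rootSubgroup hij h a) hu, v, hv, u', hu', d, ?_⟩
  rw [map_mul, hd]
  simp only [map_mul, mul_assoc]

/-- Negative roots are handled by induction on the height `i - j`: beyond simple roots, `x_ij` is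
generated by commutators of `x_ik` and `x_kj` with `k = j + 1`. -/
theorem hasGauss_mul (hR : HasStableRankOne R) (hn : 3 ≤ n)
    (he : CompleteOrthogonalIdempotents e) (hM : ∀ i j, MoritaEquivalent (e i) (e j))
    {i j : Fin n} (hij : i ≠ j) (a : peirce e i j) :
    ∀ y, HasGauss he y → HasGauss he (steinbergX e hij a * y) := by
  rcases lt_or_gt_of_ne hij with h | h
  · exact fun y => hasGauss_mul_of_pos he hij h a
  induction hm : (i : ℕ) - j using Nat.strong_induction_on generalizing i j with
  | _ m ih =>
    rw [Fin.lt_def] at h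
    by_cases hs : (i : ℕ) = j + 1
    · exact fun y => hasGauss_mul_of_simple hR hn he hM hij hs a
    obtain ⟨k, hk⟩ : ∃ k : Fin n, (k : ℕ) = j + 1 := ⟨⟨j + 1, by omega⟩, rfl⟩
    have hik : i ≠ k := by rw [Ne, Fin.ext_iff]; omega
    have hkj : k ≠ j := by rw [Ne, Fin.ext_iff]; omega
    have h₁ : ∀ a : peirce e i k, ∀ y, HasGauss he y → HasGauss he (steinbergX e hik a * y) :=
      fun a => ih (i - k) (by omega) hik a (by rw [Fin.lt_def]; omega) rfl
    have h₂ : ∀ a : peirce e k j, ∀ y, HasGauss he y → HasGauss he (steinbergX e hkj a * y) :=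
      fun a y => hasGauss_mul_of_simple hR hn he hM hkj hk a
    -- Stability for `a` does not formally give stability for `-a`, so the inductive predicate
    -- carries both.
    refine peirce_induction he.toOrthogonalIdempotents (hM k i).1
      (P := fun a => (∀ y, HasGauss he y → HasGauss he (steinbergX e hij a * y)) ∧
        ∀ y, HasGauss he y → HasGauss he (steinbergX e hij (-a) * y)) ?_ ?_ ?_ ?_ a |>.1
    · intro b c
      have key : ∀ (b : peirce e i k) (c : peirce e k j) y, HasGauss he y →
          HasGauss he (steinbergX e hij (peirceMul b c) * y) := by
        intro b c y hy
        rw [← steinbergX_mul hik hkj hij, commutatorElement_def, ← steinbergX_neg,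
          ← steinbergX_neg, mul_assoc, mul_assoc, mul_assoc]
        exact h₁ _ _ (h₂ _ _ (h₁ _ _ (h₂ _ _ hy)))
      refine ⟨key b c, ?_⟩
      have hneg : -peirceMul b c = peirceMul (-b) c :=
        Subtype.ext (neg_mul (b : R) (c : R)).symm
      rw [hneg]
      exact key (-b) c
    · rw [neg_zero, steinbergX_zero]
      simp
    · intro b c hb hc
      rw [neg_add]
      constructor <;> intro y hy <;> rw [← steinbergX_add, mul_assoc]
      exacts [hb.1 _ (hc.1 _ hy), hb.2 _ (hc.2 _ hy)]
    · intro b hb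
      rw [neg_neg]
      exact hb.symm

theorem hasGauss (hR : HasStableRankOne R) (hn : 3 ≤ n)
    (he : CompleteOrthogonalIdempotents e) (hM : ∀ i j, MoritaEquivalent (e i) (e j))
    (x : Steinberg e) : HasGauss he x := by
  refine rootSubgroup_induction (P := HasGauss he) ?_ ?_ (mem_rootSubgroup_univ x)
  · exact ⟨1, one_mem _, 1, one_mem _, 1, one_mem _, 1, by simp⟩
  · intro i j hij a _ y _ hy
    exact hasGauss_mul hR hn he hM hij a y hy

theorem sum_idem_mul (he : CompleteOrthogonalIdempotents e) (r : R) : ∑ k, e k * r = r := by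
  rw [← Finset.sum_mul, he.complete, one_mul]

/-- A unitriangular matrix which is a diagonal one is trivial. -/
theorem eq_one_of_offdiag (he : CompleteOrthogonalIdempotents e) {g : Rˣ}
    (h₁ : ∀ i, e i * (g : R) * e i = e i) (h₂ : ∀ i j, i ≠ j → e i * (g : R) * e j = 0) :
    g = 1 := by
  have h := diag_commute he h₂
  refine Units.ext ?_
  rw [Units.val_one, ← sum_idem_mul he (g : R), ← he.complete]
  refine Finset.sum_congr rfl fun i _ => ?_
  calc e i * (g : R) = e i * (e i * (g : R)) := by rw [← mul_assoc, (he.idem i).eq]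
    _ = e i := by rw [h i, ← mul_assoc, h₁]

/-- In `GL(R)` the element `v` equals `u⁻¹ d⁻¹ u'⁻¹`, so it is both lower unitriangular and upper
triangular, hence trivial. Then `u u'` is unitriangular and diagonal. -/
theorem eq_one_of_gauss (he : CompleteOrthogonalIdempotents e) {u v u' : Steinberg e}
    (hu : u ∈ rootSubgroup e (posRoots n)) (hv : v ∈ rootSubgroup e (negRoots n))
    (hu' : u' ∈ rootSubgroup e (posRoots n)) {d : diagGroup he}
    (h : st he.toOrthogonalIdempotents (u * v * u') * d = 1) : u * v * u' = 1 ∧ d = 1 := by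
  have he' := he.toOrthogonalIdempotents
  have hpos := isUnipotentRootSet_posRoots n
  have hneg := isUnipotentRootSet_negRoots n
  have hstv : st he' v = st he' u⁻¹ * ((d : Rˣ)⁻¹ * st he' u'⁻¹) := by
    rw [map_mul, map_mul, mul_eq_one_iff_eq_inv] at h
    rw [← h, map_inv, map_inv]
    group
  have hv1 : v = 1 := by
    refine hneg.eq_one_of_st_eq_one he' hv ?_
    obtain ⟨h₁, h₂⟩ := hneg.st_apply he' hv
    refine eq_one_of_offdiag he h₁ fun i j hij => ?_
    rcases lt_or_gt_of_ne hij with hlt | hgt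
    · exact h₂ i j hij (not_lt_of_gt hlt)
    · obtain ⟨-, h₃⟩ := hpos.st_apply he' (inv_mem hu)
      obtain ⟨-, h₄⟩ := hpos.st_apply he' (inv_mem hu')
      have hdc : ∀ k, e k * (((d : Rˣ)⁻¹ : Rˣ) : R) = (((d : Rˣ)⁻¹ : Rˣ) : R) * e k :=
        diag_commute he (d⁻¹).2
      rw [hstv, Units.val_mul, Units.val_mul,
        ← sum_idem_mul he ((((d : Rˣ)⁻¹ : Rˣ) : R) * (st he' u'⁻¹ : R)), Finset.mul_sum,
        Finset.mul_sum, Finset.sum_mul]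
      refine Finset.sum_eq_zero fun k _ => ?_
      have hk : e i * ((st he' u⁻¹ : R) * (e k * ((((d : Rˣ)⁻¹ : Rˣ) : R) * (st he' u'⁻¹ : R)))) *
          e j = (e i * (st he' u⁻¹ : R) * e k) * (((d : Rˣ)⁻¹ : Rˣ) : R) *
            (e k * (st he' u'⁻¹ : R) * e j) := by
        calc _ = (e i * (st he' u⁻¹ : R)) * (e k * e k * (((d : Rˣ)⁻¹ : Rˣ) : R)) *
              (st he' u'⁻¹ : R) * e j := by
              rw [(he.idem k).eq]; simp only [mul_assoc]
          _ = _ := by rw [mul_assoc (e k), hdc]; simp only [mul_assoc]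
      rw [hk]
      -- Here `j < i`, so each `k` lies either strictly above `j` or strictly below `i`, and one of
      -- the two upper triangular factors vanishes.
      by_cases hik : i ≤ k
      · rw [h₄ k j (ne_of_gt (lt_of_lt_of_le hgt hik)) (not_lt_of_gt (lt_of_lt_of_le hgt hik)),
          mul_zero]
      · have hki : k < i := lt_of_not_ge hik
        rw [h₃ i k (ne_of_gt hki) (not_lt_of_gt hki), zero_mul, zero_mul]
  subst hv1
  rw [mul_one] at h ⊢
  have huu : u * u' = 1 := by
    refine hpos.eq_one_of_st_eq_one he' (mul_mem hu hu') ?_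
    refine eq_one_of_offdiag he (hpos.st_apply he' (mul_mem hu hu')).1 ?_
    rw [eq_inv_of_mul_eq_one_left h]
    exact (d⁻¹).2
  refine ⟨huu, ?_⟩
  rw [huu, map_one, one_mul] at h
  exact Subtype.ext h

/-- The kernel of `St(R) ⋊ D(R) → GL(R)` acts trivially on `St(R)`. -/
theorem ker_steinbergDiagToGL_le (hR : HasStableRankOne R) (hn : 3 ≤ n)
    (he : CompleteOrthogonalIdempotents e) (hM : ∀ i j, MoritaEquivalent (e i) (e j)) :
    (steinbergDiagToGL he).ker ≤ (steinbergDiagAct he).ker := by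
  rintro ⟨x, g⟩ hx
  have hx' : st he.toOrthogonalIdempotents x * g = 1 := hx
  obtain ⟨u, hu, v, hv, u', hu', d, hd⟩ := hasGauss hR hn he hM x
  have hsnd : st he.toOrthogonalIdempotents x =
      st he.toOrthogonalIdempotents (u * v * u') * d := congrArg Prod.snd hd
  obtain ⟨h₁, h₂⟩ := eq_one_of_gauss he hu hv hu' (d := d * g) (by
    rw [← hx', hsnd]
    exact (mul_assoc _ _ _).symm)
  -- The decomposition collapses to its diagonal part: `x` acts on `St(R)` exactly as `g⁻¹`.
  rw [h₁, map_one, one_mul, eq_inv_of_mul_eq_one_left h₂] at hd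
  have hfst : MulAut.conj x = diagAct he g⁻¹ := congrArg Prod.fst hd
  change MulAut.conj x * diagAct he g = 1
  rw [hfst, map_inv, inv_mul_cancel]

/-! ### Generation of `GL(R)` by elementary and diagonal elements. -/

/-- Realizes in the image of `st` the block transvections between `e_k` and a sum of other
idempotents that elimination calls for; `exists_st_eq_col` is the transposed version. -/
theorem exists_st_eq_row (he : OrthogonalIdempotents e) {k : Fin n} {p : R} (hp : e k * p = p)
    (s : Finset (Fin n)) (hs : k ∉ s) :
    ∃ x : Steinberg e, (st he x : R) = 1 + p * ∑ j ∈ s, e j := by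
  induction s using Finset.induction_on with
  | empty => exact ⟨1, by simp⟩
  | insert j s hj ih =>
    obtain ⟨x, hx⟩ := ih (fun h => hs (Finset.mem_insert_of_mem h))
    have hkj : k ≠ j := fun h => hs (h ▸ Finset.mem_insert_self _ _)
    refine ⟨steinbergX e hkj ⟨p * e j, p, by rw [hp]⟩ * x, ?_⟩
    have hjk : e j * e k = 0 := he.ortho hkj.symm
    have hjp : e j * p = 0 := by rw [← hp, ← mul_assoc, hjk, zero_mul]
    rw [map_mul, Units.val_mul, st_x_val, hx, Finset.sum_insert hj]
    calc (1 + p * e j) * (1 + p * ∑ j ∈ s, e j)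
        = 1 + p * (e j + ∑ j ∈ s, e j) + p * (e j * p) * ∑ j ∈ s, e j := by noncomm_ring
      _ = _ := by rw [hjp, mul_zero, zero_mul, add_zero]

theorem exists_st_eq_col (he : OrthogonalIdempotents e) {k : Fin n} {q : R} (hq : q * e k = q)
    (s : Finset (Fin n)) (hs : k ∉ s) :
    ∃ x : Steinberg e, (st he x : R) = 1 + (∑ j ∈ s, e j) * q := by
  induction s using Finset.induction_on with
  | empty => exact ⟨1, by simp⟩
  | insert j s hj ih =>
    obtain ⟨x, hx⟩ := ih (fun h => hs (Finset.mem_insert_of_mem h))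
    have hkj : j ≠ k := fun h => hs (h ▸ Finset.mem_insert_self _ _)
    refine ⟨x * steinbergX e hkj ⟨e j * q, q, by rw [mul_assoc, hq]⟩, ?_⟩
    have hjk : e k * e j = 0 := he.ortho hkj.symm
    have hjp : q * e j = 0 := by rw [← hq, mul_assoc, hjk, mul_zero]
    rw [map_mul, Units.val_mul, st_x_val, hx, Finset.sum_insert hj]
    calc (1 + (∑ j ∈ s, e j) * q) * (1 + e j * q)
        = 1 + (e j + ∑ j ∈ s, e j) * q + (∑ j ∈ s, e j) * (q * e j) * q := by noncomm_ring
      _ = _ := by rw [hjp, mul_zero, zero_mul, add_zero]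

/-- Elimination one pivot at a time. Having split off the first `m` idempotents, the matrix commutes
with the sum of the rest, which is cut into `e_m` and the later ones. The last clause of
`exists_block_diagonal` preserves the earlier progress. -/
theorem exists_commute_idem (hR : HasStableRankOne R) (he : CompleteOrthogonalIdempotents e)
    (g : Rˣ) (m : ℕ) (hm : m ≤ n) :
    ∃ x y : Steinberg e, ∀ i : Fin n, (i : ℕ) < m →
      Commute ((st he.toOrthogonalIdempotents x * g * st he.toOrthogonalIdempotents y : Rˣ) : R)
        (e i) := by
  have he' := he.toOrthogonalIdempotents
  induction m with
  | zero => exact ⟨1, 1, fun i hi => absurd hi (Nat.not_lt_zero _)⟩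
  | succ m ih =>
    obtain ⟨x, y, hxy⟩ := ih (Nat.le_of_succ_le hm)
    obtain ⟨k, hk⟩ : ∃ k : Fin n, (k : ℕ) = m := ⟨⟨m, hm⟩, rfl⟩
    obtain ⟨g', hg'⟩ : ∃ g', g' = st he' x * g * st he' y := ⟨_, rfl⟩
    rw [← hg'] at hxy
    set s := Finset.Ioi k with hs
    have hks : k ∉ s := by simp [hs]
    have hcom : Commute (g' : R) (e k + ∑ j ∈ s, e j) := by
      have h : e k + ∑ j ∈ s, e j = 1 - ∑ j ∈ Finset.Iio k, e j := by
        rw [eq_sub_iff_add_eq, ← he.complete, ← Finset.sum_insert hks, ← Finset.sum_union]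
        · congr 1
          ext j
          simpa [hs, or_comm] using le_or_gt k j
        · rw [Finset.disjoint_left]
          intro j hj hj'
          simp only [hs, Finset.mem_insert, Finset.mem_Ioi, Finset.mem_Iio] at hj hj'
          rcases hj with rfl | hj
          exacts [lt_irrefl _ hj', lt_asymm hj hj']
      rw [h]
      refine (Commute.one_right _).sub_right (Commute.sum_right _ _ _ fun j hj => hxy j ?_)
      rw [← hk]
      exact Fin.lt_def.1 (Finset.mem_Iio.1 hj)
    have hkf : e k * ∑ j ∈ s, e j = 0 := he'.mul_sum_of_notMem hks
    have hfk : (∑ j ∈ s, e j) * e k = 0 := by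
      rw [Finset.sum_mul]
      exact Finset.sum_eq_zero fun j hj => he.ortho (fun h => hks (h ▸ hj))
    obtain ⟨p, q, r, ⟨hp₁, hp₂⟩, ⟨hq₁, hq₂⟩, ⟨hr₁, hr₂⟩, hck, -, hc⟩ :=
      hR.exists_block_diagonal (he.idem k).eq he'.isIdempotentElem_sum.eq hkf hfk g' hcom
    obtain ⟨a, ha⟩ := exists_st_eq_row he' hp₁ s hks
    obtain ⟨b, hb⟩ := exists_st_eq_col he' hq₂ s hks
    obtain ⟨c, hc'⟩ := exists_st_eq_row he' hr₁ s hks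
    rw [hp₂] at ha
    rw [hq₁] at hb
    rw [hr₂] at hc'
    refine ⟨b * a * x, y * c, fun i hi => ?_⟩
    have hval : ((st he' (b * a * x) * g * st he' (y * c) : Rˣ) : R) =
        (1 + q) * (1 + p) * g' * (1 + r) := by
      rw [← ha, ← hb, ← hc', hg']
      simp only [map_mul, Units.val_mul, mul_assoc]
    rw [hval]
    rcases Nat.lt_succ_iff_lt_or_eq.1 hi with h | h
    · have hik : i ≠ k := by rw [Ne, Fin.ext_iff]; omega
      have his : i ∉ s := by
        simp only [hs, Finset.mem_Ioi, Fin.lt_def]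
        omega
      refine hc _ (he.ortho hik) (he.ortho hik.symm) (he'.mul_sum_of_notMem his) ?_ (hxy i h)
      rw [Finset.sum_mul]
      exact Finset.sum_eq_zero fun j hj => he.ortho (fun h => his (h ▸ hj))
    · obtain rfl : i = k := Fin.ext (h.trans hk.symm)
      exact hck

/-- `GL(R)` is generated by elementary transvections and diagonal elements. -/
theorem steinbergDiagToGL_surjective (hR : HasStableRankOne R)
    (he : CompleteOrthogonalIdempotents e) : Function.Surjective (steinbergDiagToGL he) := by
  intro g
  obtain ⟨x, y, hxy⟩ := exists_commute_idem hR he g n le_rfl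
  have hd := mem_diagGroup_of_commute he (fun i => hxy i i.2)
  refine ⟨SemidirectProduct.inl x⁻¹ * SemidirectProduct.inr ⟨_, hd⟩ *
    SemidirectProduct.inl y⁻¹, ?_⟩
  simp only [steinbergDiagToGL, map_mul, SemidirectProduct.lift_inl, SemidirectProduct.lift_inr,
    map_inv, Subgroup.subtype_apply]
  group

/-! ### Uniqueness and construction of the crossed module. -/

/-- Two automorphisms of `St(R)` which agree modulo the center are equal. -/
theorem hom_ext_of_mod_center (hn : 3 ≤ n) (he : OrthogonalIdempotents e)
    (hM : ∀ i j, MoritaEquivalent (e i) (e j)) {f g : Steinberg e →* Steinberg e}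
    (h : ∀ x, f x * (g x)⁻¹ ∈ Subgroup.center (Steinberg e)) : f = g := by
  -- Central factors cancel in commutators.
  have hcomm : ∀ x y : Steinberg e, f ⁅x, y⁆ = g ⁅x, y⁆ := by
    intro x y
    obtain ⟨z, hz⟩ : ∃ z, z = f x * (g x)⁻¹ := ⟨_, rfl⟩
    obtain ⟨t, ht⟩ : ∃ t, t = f y * (g y)⁻¹ := ⟨_, rfl⟩
    have hzc : ∀ w, w * z = z * w := Subgroup.mem_center_iff.1 (hz ▸ h x)
    have htc : ∀ w, w * t = t * w := Subgroup.mem_center_iff.1 (ht ▸ h y)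
    have hx : f x = z * g x := by rw [hz, inv_mul_cancel_right]
    have hy : f y = t * g y := by rw [ht, inv_mul_cancel_right]
    rw [map_commutatorElement, map_commutatorElement, hx, hy, commutatorElement_def,
      commutatorElement_def]
    calc z * g x * (t * g y) * (z * g x)⁻¹ * (t * g y)⁻¹
        = z * (g x * t) * (g y * (g x)⁻¹) * z⁻¹ * (g y)⁻¹ * t⁻¹ := by group
      _ = z * t * (g x * g y * (g x)⁻¹ * z⁻¹) * (g y)⁻¹ * t⁻¹ := by rw [htc]; group
      _ = t * z * (g x * g y * (g x)⁻¹ * z⁻¹) * (g y)⁻¹ * t⁻¹ := by rw [htc]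
      _ = t * ((z * (g x * g y * (g x)⁻¹)) * z⁻¹) * (g y)⁻¹ * t⁻¹ := by group
      _ = t * (g x * g y * (g x)⁻¹ * (g y)⁻¹) * t⁻¹ := by rw [← hzc]; group
      _ = g x * g y * (g x)⁻¹ * (g y)⁻¹ := by rw [← htc]; group
  refine steinberg_hom_ext fun {i j} hij a => ?_
  obtain ⟨k, hki, hkj⟩ := exists_ne_ne hn i j
  -- `St(R)` is perfect: with a third index `k`, each `x_ij(a)` is a product of commutators and
  -- their inverses.
  refine peirce_induction he (hM k i).1
    (P := fun a => f (steinbergX e hij a) = g (steinbergX e hij a)) ?_ ?_ ?_ ?_ a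
  · intro b c
    rw [← steinbergX_mul hki.symm hkj hij, hcomm]
  · rw [steinbergX_zero, map_one, map_one]
  · intro a b ha hb
    rw [← steinbergX_add, map_mul, map_mul, ha, hb]
  · intro a ha
    rw [steinbergX_neg, map_inv, map_inv, ha]

/-- A crossed module structure on `st` is compatible with the action of `St(R) ⋊ D(R)`. -/
theorem IsCrossedModule.comp_steinbergDiagToGL (hn : 3 ≤ n)
    (he : CompleteOrthogonalIdempotents e) (hM : ∀ i j, MoritaEquivalent (e i) (e j))
    {φ : Rˣ →* MulAut (Steinberg e)} (hφ : IsCrossedModule (st he.toOrthogonalIdempotents) φ) :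
    φ.comp (steinbergDiagToGL he) = steinbergDiagAct he := by
  refine SemidirectProduct.hom_ext ?_ ?_
  · ext x y
    simp [steinbergDiagToGL, steinbergDiagAct, hφ.peiffer]
  · refine MonoidHom.ext fun g => MulEquiv.ext fun x => ?_
    simp only [steinbergDiagToGL, steinbergDiagAct, MonoidHom.comp_apply,
      SemidirectProduct.lift_inr, Subgroup.subtype_apply]
    have h : (φ (g : Rˣ)).toMonoidHom = (diagAct he g).toMonoidHom := by
      refine hom_ext_of_mod_center hn he.toOrthogonalIdempotents hM fun x => ?_
      have hst : st he.toOrthogonalIdempotents (φ (g : Rˣ) x * (diagAct he g x)⁻¹) = 1 := by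
        rw [map_mul, map_inv, hφ.equivariant, st_diagAct, mul_inv_cancel]
      refine Subgroup.mem_center_iff.2 fun y => ?_
      -- The discrepancy lies in `ker st`, so by the Peiffer identity conjugation by it is the
      -- trivial action.
      have hp := hφ.peiffer (φ (g : Rˣ) x * (diagAct he g x)⁻¹) y
      rw [hst, map_one, MulAut.one_apply, eq_mul_inv_iff_mul_eq] at hp
      exact hp
    exact DFunLike.congr_fun h x

theorem exists_isCrossedModule (hR : HasStableRankOne R) (hn : 3 ≤ n)
    (he : CompleteOrthogonalIdempotents e) (hM : ∀ i j, MoritaEquivalent (e i) (e j)) :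
    ∃ φ : Rˣ →* MulAut (Steinberg e), IsCrossedModule (st he.toOrthogonalIdempotents) φ := by
  let φ := (steinbergDiagToGL he).liftOfSurjective (steinbergDiagToGL_surjective hR he)
    ⟨steinbergDiagAct he, ker_steinbergDiagToGL_le hR hn he hM⟩
  have hφ : ∀ z, φ (steinbergDiagToGL he z) = steinbergDiagAct he z :=
    (steinbergDiagToGL he).liftOfRightInverse_comp_apply _ _ _
  refine ⟨φ, ⟨fun g y => ?_⟩, fun x y => ?_⟩
  · obtain ⟨⟨x, d⟩, rfl⟩ := steinbergDiagToGL_surjective hR he g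
    rw [hφ]
    change st _ (x * diagAct he d y * x⁻¹) = (st _ x * (d : Rˣ)) * st _ y * (st _ x * (d : Rˣ))⁻¹
    rw [map_mul, map_mul, st_diagAct, map_inv]
    group
  · have h := hφ (SemidirectProduct.inl x)
    simp only [steinbergDiagToGL, steinbergDiagAct, SemidirectProduct.lift_inl] at h
    rw [h, MulAut.conj_apply]

end Gauss

end IsotropicGL

theorem mainTheorem2 {R : Type*} [Ring R] (hR : IsotropicGL.IsSemiLocalRing R)
    {n : ℕ} (hn : 3 ≤ n) (e : Fin n → R) (he : CompleteOrthogonalIdempotents e)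
    (hM : ∀ i j : Fin n, IsotropicGL.MoritaEquivalent (e i) (e j)) :
    (∃! φ : Rˣ →* MulAut (IsotropicGL.Steinberg e),
      IsotropicGL.IsCrossedModule (IsotropicGL.st he.toOrthogonalIdempotents) φ) ∧
    (∀ φ : Rˣ →* MulAut (IsotropicGL.Steinberg e),
      IsotropicGL.IsCrossedModule (IsotropicGL.st he.toOrthogonalIdempotents) φ →
        φ.comp (IsotropicGL.steinbergDiagToGL he) = IsotropicGL.steinbergDiagAct he) := by
  have hsr := hR.hasStableRankOne
  refine ⟨?_, fun φ hφ => hφ.comp_steinbergDiagToGL hn he hM⟩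
  obtain ⟨φ, hφ⟩ := IsotropicGL.exists_isCrossedModule hsr hn he hM
  refine ⟨φ, hφ, fun ψ hψ => ?_⟩
  -- Both actions pull back to the same action along a surjection.
  rw [← MonoidHom.cancel_right (IsotropicGL.steinbergDiagToGL_surjective hsr he),
    hφ.comp_steinbergDiagToGL hn he hM, hψ.comp_steinbergDiagToGL hn he hM]
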